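/- Let $f:\mathbb C\to\mathbb C$ be a transcendental entire function (entire and not a polynomial). Write $f^n$ for the $n$th iterate of $f$. The Fatou set $F(f)$ is the set of points $z\in\mathbb C$ having a neighbourhood on which $(f^n)_{n\in\mathbb N}$ is a normal family; its connected components are called Fatou components, and $J(f)=\mathbb C\setminus F(f)$ is the Julia set. A Fatou component $U$ is multiply connected if its complement $\widehat{\mathbb C}\setminus U$ in the Riemann sphere is not connected. For $r>0$ let $M(r)=\max_{|z|=r}|f(z)|$, and let $M^n$ denote the $n$th iterate of the function $r\mapsto M(r)$, with $M^0(r)=r$. Let $R>0$ be such that $M(r)>r$ for all $r\ge R$, and for $L\in\mathbb Z$ let $$A_R^L(f)=\{z\in\mathbb C:\ |f^n(z)|\ge M^{n+L}(R)\ \text{ for all integers } n\ge 0 \text{ with } n+L\ge 0\}.$$ Then, for every $L\in\mathbb Z$, all the connected components of $A_R^L(f)\cap J(f)$ are unbounded if and only if $f$ has no multiply connected Fatou components. -/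

import Mathlib

open Set Filter Topology

noncomputable section

namespace FastEscaping

/-- A transcendental entire function: holomorphic on the whole plane and not a polynomial. -/
def IsTranscendentalEntire (f : ℂ → ℂ) : Prop :=
  Differentiable ℂ f ∧ ¬ ∃ p : Polynomial ℂ, ∀ z, f z = p.eval z

/-- `M(r, f) = max_{|z| = r} |f(z)|`. For continuous `f` and `0 ≤ r` the circle is compact and
non-empty, so this supremum is an attained maximum. -/
def maxModulus (f : ℂ → ℂ) (r : ℝ) : ℝ :=
  sSup ((fun z => ‖f z‖) '' Metric.sphere (0 : ℂ) r)

/-- Normality, in the classical sense for families of entire functions, of the family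
`{F n : n ∈ ℕ}` on a domain `D`: every sequence of members of the family has a subsequence that
converges uniformly on compact subsets of `D`, either to a finite limit function or to `∞`. -/
def IsNormalFamilyOn (F : ℕ → ℂ → ℂ) (D : Set ℂ) : Prop :=
  ∀ s : ℕ → ℕ, ∃ φ : ℕ → ℕ, StrictMono φ ∧
    ((∃ g : ℂ → ℂ, TendstoLocallyUniformlyOn (fun k => F (s (φ k))) g atTop D) ∨
      (∀ K ⊆ D, IsCompact K → ∀ B : ℝ, ∀ᶠ k in atTop, ∀ z ∈ K, B < ‖F (s (φ k)) z‖))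

/-- The Fatou set: the points with a neighbourhood (it may be taken to be a disc) on which the
iterates of `f` form a normal family. -/
def fatouSet (f : ℂ → ℂ) : Set ℂ :=
  {z | ∃ r > 0, IsNormalFamilyOn (fun n => f^[n]) (Metric.ball z r)}

/-- The Julia set: the complement of the Fatou set. -/
def juliaSet (f : ℂ → ℂ) : Set ℂ := (fatouSet f)ᶜ

/-- The level `A_R^L(f)`: the set of all `z` with `|f^n(z)| ≥ M^{n+L}(R, f)` for all natural
numbers `n` with `n + L ≥ 0`. -/
def level (f : ℂ → ℂ) (R : ℝ) (L : ℤ) : Set ℂ :=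
  {z | ∀ n : ℕ, 0 ≤ (n : ℤ) + L → (maxModulus f)^[((n : ℤ) + L).toNat] R ≤ ‖f^[n] z‖}

/-- `C` is a connected component of the set `S` (with its subspace topology). -/
def IsComponentOf (C S : Set ℂ) : Prop :=
  ∃ z ∈ S, C = connectedComponentIn S z

/-- A plane domain is multiply connected if its connectivity (the number of components of its
complement in the Riemann sphere) is greater than `1`, that is, if this complement, which
always contains `∞`, is not connected. -/
def IsMultiplyConnected (U : Set ℂ) : Prop :=
  ¬ IsConnected (((↑) : ℂ → OnePoint ℂ) '' U)ᶜ

end FastEscaping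

end

/-! Write A for the level, which is closed; J and F are the Julia and Fatou sets. Every component of
A is unbounded: the constraints defining A are nested by the maximum principle, so a bounded open
set meeting A has a frontier point in A (`not_isBounded_connectedComponentIn_level`).

Suppose no Fatou component is multiply connected. On a disc in F the iterates omit a point a of J,
and they cover no circle about a, since that circle would lie in a multiply connected component. A
Bloch-type argument then makes |f^n - a| comparable on the half disc, uniformly in n. An orbit that
falls below the iterated maximum modulus falls behind by an unbounded factor, so a Fatou component
meeting A lies in A (`subset_level_of_mem`). If z in A ∩ J had a bounded component there, a bounded
open W around z would have connected frontier missing A ∩ J (unicoherence of the plane). The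
unbounded component of A through z crosses this frontier inside some Fatou component U. The closure
of U lies in A, so U is relatively clopen in the frontier and contains all of it; U then surrounds z
and is multiply connected.

Conversely, a multiply connected U surrounds a point of J. Non-normality there forces some f^m(U) to
contain the frontier of a bounded open set covering any prescribed disc, so f^m(U), a subset of F,
meets every unbounded connected set that meets the disc. Hence A ∩ J has a bounded component if it
is nonempty. If A ∩ J is empty, A is a nonempty subset of F, and the components of A through z and
f(z) both meet f^m(U), which puts z and f(z) in one Fatou component. Harnack's inequality then
bounds log|f^(n+1)(z)| by C log|f^n(z)|, too slow for a point of A (`not_mem_of_map_mem`). -/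

namespace FastEscaping

/-! ### Maximum modulus: monotonicity, growth and convexity -/

section MaximumModulus

variable {f : ℂ → ℂ}

lemma IsTranscendentalEntire.not_const (hf : IsTranscendentalEntire f) :
    ¬ ∃ c, ∀ z, f z = c := by
  rintro ⟨c, hc⟩
  exact hf.2 ⟨Polynomial.C c, fun z => by simp [hc z]⟩

lemma norm_le_maxModulus_of_mem_sphere (hf : Continuous f) {z : ℂ} {r : ℝ}
    (hz : z ∈ Metric.sphere (0 : ℂ) r) : ‖f z‖ ≤ maxModulus f r :=
  le_csSup ((isCompact_sphere (0 : ℂ) r).image (by fun_prop)).bddAbove ⟨z, hz, rfl⟩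

lemma exists_norm_eq_maxModulus (hf : Continuous f) {r : ℝ} (hr : 0 ≤ r) :
    ∃ z, ‖z‖ = r ∧ ‖f z‖ = maxModulus f r := by
  have hne : (Metric.sphere (0 : ℂ) r).Nonempty := NormedSpace.sphere_nonempty.mpr hr
  obtain ⟨z, hz, h⟩ := ((isCompact_sphere (0 : ℂ) r).image (f := fun z => ‖f z‖)
    (by fun_prop)).sSup_mem (hne.image _)
  exact ⟨z, by simpa using hz, h⟩

lemma maxModulus_nonneg (r : ℝ) : 0 ≤ maxModulus f r := by
  apply Real.sSup_nonneg
  rintro _ ⟨z, -, rfl⟩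
  exact norm_nonneg _

lemma norm_le_maxModulus (hf : Differentiable ℂ f) {z : ℂ} {r : ℝ} (hz : ‖z‖ ≤ r) :
    ‖f z‖ ≤ maxModulus f r := by
  rcases eq_or_ne r 0 with rfl | hr
  · exact norm_le_maxModulus_of_mem_sphere hf.continuous
      (by simpa using le_antisymm hz (norm_nonneg z))
  · refine Complex.norm_le_of_forall_mem_frontier_norm_le (U := Metric.ball 0 r)
      Metric.isBounded_ball hf.diffContOnCl (fun w hw => ?_) ?_
    · rw [frontier_ball _ hr] at hw
      exact norm_le_maxModulus_of_mem_sphere hf.continuous hw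
    · rw [closure_ball _ hr]; simpa using hz

lemma maxModulus_mono (hf : Differentiable ℂ f) {r s : ℝ} (hr : 0 ≤ r) (hrs : r ≤ s) :
    maxModulus f r ≤ maxModulus f s := by
  obtain ⟨z, hz, h⟩ := exists_norm_eq_maxModulus hf.continuous hr
  exact h ▸ norm_le_maxModulus hf (hz.trans_le hrs)

lemma maxModulus_strictMono (hf : Differentiable ℂ f) (hc : ¬ ∃ c, ∀ z, f z = c) {r s : ℝ}
    (hr : 0 ≤ r) (hrs : r < s) : maxModulus f r < maxModulus f s := by
  refine lt_of_le_of_ne (maxModulus_mono hf hr hrs.le) fun he => hc ?_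
  obtain ⟨z, hz, h⟩ := exists_norm_eq_maxModulus hf.continuous hr
  have hzs : z ∈ Metric.ball (0 : ℂ) s := by simpa [hz] using hrs
  have hmax : IsMaxOn (norm ∘ f) (Metric.ball (0 : ℂ) s) z := fun w hw => by
    simp only [mem_ofPred_eq, Function.comp_apply, h, he]
    exact norm_le_maxModulus hf (by simpa using (mem_ball_zero_iff.mp hw).le)
  have := Complex.eqOn_of_isPreconnected_of_isMaxOn_norm (convex_ball (0 : ℂ) s).isPreconnected
    Metric.isOpen_ball hf.differentiableOn hzs hmax
  refine ⟨f z, fun w => ?_⟩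
  have han : AnalyticOnNhd ℂ f univ := fun w _ => hf.analyticAt w
  exact han.eqOn_of_preconnected_of_eventuallyEq analyticOnNhd_const isPreconnected_univ
    (mem_univ z) (by filter_upwards [Metric.isOpen_ball.mem_nhds hzs] with w hw using this hw)
    (mem_univ w)

lemma maxModulus_pos (hf : Differentiable ℂ f) (hc : ¬ ∃ c, ∀ z, f z = c) {r : ℝ}
    (hr : 0 < r) : 0 < maxModulus f r :=
  (maxModulus_nonneg 0).trans_lt (maxModulus_strictMono hf hc le_rfl hr)

/-- An entire function of polynomial growth along a sequence of radii is a polynomial. -/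
lemma eventually_pow_le_maxModulus (hf : IsTranscendentalEntire f) (k : ℕ) :
    ∀ᶠ r in atTop, r ^ k ≤ maxModulus f r := by
  by_contra hcon
  have hfr : ∃ᶠ r in atTop, maxModulus f r < r ^ k := by
    simpa only [not_eventually, not_le] using hcon
  refine hf.2 ?_
  -- Cauchy's estimate on radii r ≥ 1 with M(r) < r^k bounds the n-th derivative at 0 by n!/r, which
  -- tends to 0 along these radii.
  have hz : ∀ n, k < n → iteratedDeriv n f 0 = 0 := by
    intro n hn
    by_contra h0
    have hpos : 0 < ‖iteratedDeriv n f 0‖ := norm_pos_iff.mpr h0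
    have hlim : Tendsto (fun r : ℝ => (n.factorial : ℝ) / r) atTop (𝓝 0) :=
      tendsto_const_nhds.div_atTop tendsto_id
    obtain ⟨r, hr1, hr2, hr3⟩ := (hfr.and_eventually ((hlim.eventually_lt_const hpos).and
      (eventually_ge_atTop 1))).exists
    have hr0 : 0 < r := by linarith
    have hb := Complex.norm_iteratedDeriv_le_of_forall_mem_sphere_norm_le n hr0
      (hf.1.diffContOnCl (s := Metric.ball 0 r))
      (fun z hz => (norm_le_maxModulus_of_mem_sphere hf.1.continuous hz).trans hr1.le)
    refine absurd (hb.trans ?_) (not_le.mpr hr2)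
    rw [div_le_div_iff₀ (by positivity) hr0, mul_assoc, ← pow_succ]
    gcongr
    exact hn
  refine ⟨∑ n ∈ Finset.range (k + 1), Polynomial.monomial n
    ((n.factorial : ℂ)⁻¹ * iteratedDeriv n f 0), fun z => ?_⟩
  have h1 := Complex.hasSum_taylorSeries_of_entire hf.1 0 z
  have h2 : HasSum (fun n : ℕ => (n.factorial : ℂ)⁻¹ • (z - 0) ^ n • iteratedDeriv n f 0)
      (∑ n ∈ Finset.range (k + 1), (n.factorial : ℂ)⁻¹ • (z - 0) ^ n • iteratedDeriv n f 0) :=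
    hasSum_sum_of_ne_finset_zero fun n hn => by
      rw [hz n (by simpa using hn)]; simp
  rw [h1.unique h2, Polynomial.eval_finsetSum]
  refine Finset.sum_congr rfl fun n _ => ?_
  simp only [Polynomial.eval_monomial, smul_eq_mul, sub_zero]
  ring

/-- Hadamard's three circles theorem, in logarithmic form and with inner radius `1`. -/
lemma log_maxModulus_le (hf : Differentiable ℂ f) (hc : ¬ ∃ c, ∀ z, f z = c) {r s : ℝ}
    (hr : 1 < r) (hrs : r ≤ s) :
    Real.log s * Real.log (maxModulus f r) ≤
      (Real.log s - Real.log r) * Real.log (maxModulus f 1) +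
        Real.log r * Real.log (maxModulus f s) := by
  have hlr : 0 < Real.log r := Real.log_pos hr
  have hls : 0 < Real.log s := Real.log_pos (hr.trans_le hrs)
  have hlrs : Real.log r ≤ Real.log s := Real.log_le_log (by linarith) hrs
  obtain ⟨z, hz, h⟩ := exists_norm_eq_maxModulus hf.continuous (r := r) (by linarith)
  have hz0 : z ≠ 0 := by
    rintro rfl; simp at hz; linarith
  have hre : (Complex.log z).re = Real.log r := by rw [Complex.log_re, hz]
  -- Three lines theorem for f ∘ exp on the strip 0 ≤ Re w ≤ log s.
  have key := Complex.HadamardThreeLines.norm_le_interp_of_mem_verticalClosedStrip'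
    (f := fun w => f (Complex.exp w)) (z := Complex.log z) (a := maxModulus f 1)
    (b := maxModulus f s) (l := 0) (u := Real.log s) hls
    (by simpa [Complex.HadamardThreeLines.verticalClosedStrip, hre] using ⟨hlr.le, hlrs⟩)
    ((hf.comp Complex.differentiable_exp).diffContOnCl)
    ⟨maxModulus f s, by
      rintro _ ⟨w, hw, rfl⟩
      refine norm_le_maxModulus hf ?_
      rw [Complex.norm_exp]
      calc Real.exp w.re ≤ Real.exp (Real.log s) := Real.exp_le_exp.mpr hw.2
        _ = s := Real.exp_log (by linarith)⟩
    (fun w hw => norm_le_maxModulus hf (by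
      rw [Complex.norm_exp]; simp only [mem_preimage, mem_singleton_iff] at hw; simp [hw]))
    (fun w hw => norm_le_maxModulus hf (by
      rw [Complex.norm_exp]; simp only [mem_preimage, mem_singleton_iff] at hw
      rw [hw, Real.exp_log (by linarith)]))
  simp only [Complex.exp_log hz0, h, hre, sub_zero] at key
  have h1 : 0 < maxModulus f 1 := maxModulus_pos hf hc one_pos
  have h2 : 0 < maxModulus f s := maxModulus_pos hf hc (by linarith)
  have h3 : 0 < maxModulus f r := maxModulus_pos hf hc (by linarith)
  have := Real.log_le_log h3 key
  rw [Real.log_mul (by positivity) (by positivity), Real.log_rpow h1, Real.log_rpow h2] at this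
  have h4 := mul_le_mul_of_nonneg_left this hls.le
  refine h4.trans (le_of_eq ?_)
  field_simp

/-- The maximum modulus of a transcendental entire function eventually grows faster than any
power, in the multiplicative sense. -/
lemma exists_forall_pow_mul_maxModulus_le (hf : IsTranscendentalEntire f) (k : ℕ) :
    ∃ s₀ : ℝ, 1 < s₀ ∧ ∀ s S, s₀ ≤ s → s ≤ S →
      (S / s) ^ k * maxModulus f s ≤ maxModulus f S := by
  have hc := hf.not_const
  -- The spare power absorbs log M(1) ≤ log s, leaving k log s ≤ log M(s) - log M(1); convexity
  -- turns this into slope at least k beyond s.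
  obtain ⟨s₁, hs₁⟩ := eventually_atTop.mp (eventually_pow_le_maxModulus hf (k + 1))
  have h1 : 0 < maxModulus f 1 := maxModulus_pos hf.1 hc one_pos
  refine ⟨max (max s₁ (maxModulus f 1)) 2, lt_of_lt_of_le one_lt_two (le_max_right _ _),
    fun s S hs hS => ?_⟩
  have hs2 : 2 ≤ s := (le_max_right _ _).trans hs
  have hs1 : s₁ ≤ s := (le_max_left _ _).trans ((le_max_left _ _).trans hs)
  have hsM : maxModulus f 1 ≤ s := (le_max_right _ _).trans ((le_max_left _ _).trans hs)
  have hMs : 0 < maxModulus f s := maxModulus_pos hf.1 hc (by linarith)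
  have hMS : 0 < maxModulus f S := maxModulus_pos hf.1 hc (by linarith)
  have h3 := log_maxModulus_le hf.1 hc (r := s) (s := S) (by linarith) hS
  have hx : 0 < Real.log s := Real.log_pos (by linarith)
  have hxX : Real.log s ≤ Real.log S := Real.log_le_log (by linarith) hS
  have h4 : (k : ℝ) * Real.log s + Real.log (maxModulus f 1) ≤ Real.log (maxModulus f s) := by
    have := Real.log_le_log (by positivity) (hs₁ s hs1)
    rw [Real.log_pow] at this
    have h5 := Real.log_le_log h1 hsM
    push_cast at this
    linarith
  have hq : 0 < S / s := div_pos (by linarith) (by linarith)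
  rw [← Real.log_le_log_iff (by positivity) hMS, Real.log_mul (by positivity) hMs.ne',
    Real.log_pow, Real.log_div (by linarith) (by linarith)]
  have h6 := mul_le_mul_of_nonneg_left h4 (sub_nonneg.mpr hxX)
  refine le_of_mul_le_mul_left ?_ hx
  nlinarith

lemma eventually_mul_le_maxModulus (hf : IsTranscendentalEntire f) {lam : ℝ} (hl : 1 < lam)
    (c : ℝ) : ∃ s₀ : ℝ, 1 < s₀ ∧ ∀ s, s₀ ≤ s → c * maxModulus f s ≤ maxModulus f (lam * s) := by
  obtain ⟨k, hk⟩ := (tendsto_pow_atTop_atTop_of_one_lt hl).eventually_ge_atTop c |>.exists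
  obtain ⟨s₀, h1, h⟩ := exists_forall_pow_mul_maxModulus_le hf k
  refine ⟨s₀, h1, fun s hs => ?_⟩
  have hs0 : 0 < s := by linarith
  have := h s (lam * s) hs (by nlinarith)
  rw [mul_div_assoc, div_self hs0.ne', mul_one] at this
  exact (mul_le_mul_of_nonneg_right hk (maxModulus_nonneg s)).trans this

/-! ### Iterates of the maximum modulus function -/

section Iterates

variable {R : ℝ}

lemma le_maxModulus_iterate (hM : ∀ r : ℝ, R ≤ r → r < maxModulus f r) {r : ℝ} (hr : R ≤ r)
    (n : ℕ) : r ≤ (maxModulus f)^[n] r := by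
  induction n with
  | zero => simp
  | succ n ih =>
    rw [Function.iterate_succ_apply']
    exact ih.trans (hM _ (hr.trans ih)).le

lemma maxModulus_iterate_le_of_le (hM : ∀ r : ℝ, R ≤ r → r < maxModulus f r) {r : ℝ}
    (hr : R ≤ r) {m n : ℕ} (hmn : m ≤ n) : (maxModulus f)^[m] r ≤ (maxModulus f)^[n] r := by
  obtain ⟨k, rfl⟩ := Nat.exists_eq_add_of_le' hmn
  rw [Function.iterate_add_apply]
  exact le_maxModulus_iterate hM (hr.trans (le_maxModulus_iterate hM hr m)) k

lemma maxModulus_iterate_nonneg {r : ℝ} (hr : 0 ≤ r) (n : ℕ) : 0 ≤ (maxModulus f)^[n] r := by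
  cases n with
  | zero => simpa
  | succ n => rw [Function.iterate_succ_apply']; exact maxModulus_nonneg _

lemma maxModulus_iterate_mono (hf : Differentiable ℂ f) {r s : ℝ} (hr : 0 ≤ r) (hrs : r ≤ s)
    (n : ℕ) : (maxModulus f)^[n] r ≤ (maxModulus f)^[n] s := by
  induction n with
  | zero => simpa
  | succ n ih =>
    simp only [Function.iterate_succ_apply']
    exact maxModulus_mono hf (maxModulus_iterate_nonneg hr n) ih

lemma tendsto_maxModulus_iterate (hf : Differentiable ℂ f) (hR : 0 < R)
    (hM : ∀ r : ℝ, R ≤ r → r < maxModulus f r) :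
    Tendsto (fun n => (maxModulus f)^[n] R) atTop atTop := by
  have hmono : Monotone fun n => (maxModulus f)^[n] R :=
    fun m n hmn => maxModulus_iterate_le_of_le hM le_rfl hmn
  refine (tendsto_atTop_of_monotone hmono).resolve_right ?_
  rintro ⟨l, hl⟩
  have hle : ∀ n, (maxModulus f)^[n] R ≤ l := fun n => hmono.ge_of_tendsto hl n
  have hRl : R ≤ l := hle 0
  obtain ⟨z, hz, h⟩ := exists_norm_eq_maxModulus hf.continuous (r := l) (by linarith)
  refine absurd (hM l hRl) (not_lt.mpr ?_)
  rw [← h]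
  have hl0 : l ≠ 0 := by linarith
  have hfc := hf.continuous
  -- Continuity of M is not needed: a point z attaining M(l) is approached by its rescalings to the
  -- radii M^n(R), where |f| ≤ M^(n+1)(R) ≤ l.
  have hlim : Tendsto (fun n => ‖f ((((maxModulus f)^[n] R / l : ℝ) : ℂ) * z)‖) atTop
      (𝓝 ‖f (((l / l : ℝ) : ℂ) * z)‖) :=
    ((by fun_prop : Continuous fun t : ℝ => ‖f (((t / l : ℝ) : ℂ) * z)‖).tendsto l).comp hl
  rw [div_self hl0] at hlim
  simp only [Complex.ofReal_one, one_mul] at hlim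
  refine le_of_tendsto hlim (Eventually.of_forall fun n => ?_)
  refine (norm_le_maxModulus hf (r := (maxModulus f)^[n] R) ?_).trans ?_
  · have h0 := maxModulus_iterate_nonneg (f := f) hR.le n
    rw [norm_mul, Complex.norm_real, hz, Real.norm_eq_abs,
      abs_of_nonneg (div_nonneg h0 (by linarith)), div_mul_cancel₀ _ hl0]
  · rw [← Function.iterate_succ_apply' (maxModulus f)]; exact hle (n + 1)

end Iterates

end MaximumModulus

/-! ### Bloch and Harnack estimates on discs -/

section Discs

open Metric

variable {c : ℂ} {r : ℝ}

lemma exists_log_on_ball {h : ℂ → ℂ} (hd : DifferentiableOn ℂ h (ball c r))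
    (h0 : ∀ z ∈ ball c r, h z ≠ 0) :
    ∃ g : ℂ → ℂ, DifferentiableOn ℂ g (ball c r) ∧ ∀ z ∈ ball c r, Complex.exp (g z) = h z := by
  rcases le_or_gt r 0 with hr | hr
  · exact ⟨0, by simp [ball_eq_empty.mpr hr], by simp [ball_eq_empty.mpr hr]⟩
  have hc : c ∈ ball c r := mem_ball_self hr
  have hdd : DifferentiableOn ℂ (fun z => deriv h z / h z) (ball c r) :=
    (hd.deriv isOpen_ball).div hd h0
  obtain ⟨g, hgc, hg⟩ := hdd.isExactOn_ball.with_val_at c (Complex.log (h c))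
  have hdg : DifferentiableOn ℂ g (ball c r) := fun z hz =>
    (hg z hz).differentiableAt.differentiableWithinAt
  refine ⟨g, hdg, fun z hz => ?_⟩
  have hder : ∀ w ∈ ball c r, HasDerivAt (fun w => h w * Complex.exp (-g w)) 0 w := by
    intro w hw
    have h1 := (hd.differentiableAt (isOpen_ball.mem_nhds hw)).hasDerivAt
    have h2 := (hg w hw).neg.cexp
    convert! h1.mul h2 using 1
    field_simp [h0 w hw]
    ring
  have hconst := isOpen_ball.is_const_of_deriv_eq_zero (convex_ball c r).isPreconnected
    (fun w hw => (hder w hw).differentiableAt.differentiableWithinAt)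
    (fun w hw => (hder w hw).deriv) hz hc
  rw [hgc, Complex.exp_neg, Complex.exp_neg, Complex.exp_log (h0 c hc),
    mul_inv_cancel₀ (h0 c hc)] at hconst
  have := Complex.exp_ne_zero (g z)
  field_simp at hconst
  exact hconst.symm

/-- A quantitative local covering property. -/
lemma ball_subset_image_of_norm_deriv_le {g : ℂ → ℂ} (hr : 0 < r)
    (hd : DifferentiableOn ℂ g (ball c r)) (hq : 0 < ‖deriv g c‖)
    (hb : ∀ z ∈ ball c r, ‖deriv g z‖ ≤ 2 * ‖deriv g c‖) :
    ball (g c) (r * ‖deriv g c‖ / 24) ⊆ g '' ball c r := by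
  set q := ‖deriv g c‖ with hqdef
  have hsub : closedBall c (r / 6) ⊆ ball c r := closedBall_subset_ball (by linarith)
  have hat : ∀ z ∈ ball c r, DifferentiableAt ℂ g z := fun z hz =>
    hd.differentiableAt (isOpen_ball.mem_nhds hz)
  -- The Schwarz lemma for g' gives |g' - g'(c)| ≤ q/2 on the disc of radius r/6. There g is nearly
  -- affine, so |g - g(c)| ≥ (q - q/2)r/6 on its boundary; covering half this radius gives 24.
  have hmaps : MapsTo (deriv g) (ball c r) (closedBall (deriv g c) (3 * q)) := fun z hz => by
    rw [mem_closedBall, dist_eq_norm]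
    linarith [norm_sub_le (deriv g z) (deriv g c), hb z hz]
  have hder : ∀ z ∈ closedBall c (r / 6), ‖deriv (fun w => g w - deriv g c * w) z‖ ≤ q / 2 := by
    intro z hz
    have h1 := Complex.dist_le_div_mul_dist_of_mapsTo_ball (hd.deriv isOpen_ball) hmaps (hsub hz)
    have h2 : HasDerivAt (fun w => g w - deriv g c * w) (deriv g z - deriv g c * 1) z :=
      (hat z (hsub hz)).hasDerivAt.sub ((hasDerivAt_id z).const_mul _)
    rw [h2.deriv, mul_one, ← dist_eq_norm]
    refine h1.trans ?_
    calc 3 * q / r * dist z c ≤ 3 * q / r * (r / 6) := by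
          gcongr; exact hz
      _ = q / 2 := by field_simp; norm_num
  have hlow : ∀ z ∈ sphere c (r / 6), r * q / 12 ≤ ‖g z - g c‖ := by
    intro z hz
    have h1 := (convex_closedBall c (r / 6)).norm_image_sub_le_of_norm_deriv_le
      (f := fun w => g w - deriv g c * w)
      (fun w hw => (hat w (hsub hw)).sub (by fun_prop)) hder
      (mem_closedBall_self (by positivity)) (sphere_subset_closedBall hz)
    rw [mem_sphere_iff_norm] at hz
    have h2 : deriv g c * (z - c) = (g z - g c) -
        (g z - deriv g c * z - (g c - deriv g c * c)) := by ring
    have h3 := norm_sub_le (g z - g c) (g z - deriv g c * z - (g c - deriv g c * c))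
    rw [← h2, norm_mul, hz] at h3
    rw [hz] at h1
    linarith
  have hfreq : ∃ᶠ z in 𝓝 c, g z ≠ g c := by
    intro hcon
    have : g =ᶠ[𝓝 c] fun _ => g c := hcon.mono fun z hz => not_not.mp hz
    rw [hqdef, this.deriv_eq] at hq
    simp at hq
  have := DiffContOnCl.ball_subset_image_closedBall
    (DifferentiableOn.diffContOnCl (hd.mono (by rwa [closure_ball _ (by positivity)])))
    (by positivity) hlow hfreq
  rw [show r * q / 12 / 2 = r * q / 24 by ring] at this
  exact this.trans (image_mono hsub)

/-- A form of Bloch's theorem. -/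
lemma norm_deriv_le_of_forall_not_ball_subset {g : ℂ → ℂ} {ρ : ℝ} (hr : 0 < r) (hρ : 0 < ρ)
    (hd : DifferentiableOn ℂ g (ball c r)) (hno : ∀ w, ¬ ball w ρ ⊆ g '' ball c r) {z : ℂ}
    (hz : z ∈ ball c (r / 2)) : ‖deriv g z‖ ≤ 192 * ρ / r := by
  have hsub : closedBall c (3 * r / 4) ⊆ ball c r := closedBall_subset_ball (by linarith)
  -- Landau's device: maximise the derivative weighted by the distance to the boundary. Around the
  -- maximiser |g'| at most doubles, so the covering lemma yields a disc of radius dq/48. Using 3r/4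
  -- instead of r makes the domain compact.
  have hcont : ContinuousOn (fun w => (3 * r / 4 - dist w c) * ‖deriv g w‖)
      (closedBall c (3 * r / 4)) :=
    (by fun_prop : Continuous fun w => 3 * r / 4 - dist w c).continuousOn.mul
      ((hd.deriv isOpen_ball).continuousOn.mono hsub).norm
  obtain ⟨w, hw, hmax⟩ := (isCompact_closedBall c (3 * r / 4)).exists_isMaxOn
    ⟨c, mem_closedBall_self (by positivity)⟩ hcont
  set q := ‖deriv g w‖ with hq
  set d := 3 * r / 4 - dist w c with hdd
  have hmax' : ∀ u ∈ closedBall c (3 * r / 4), (3 * r / 4 - dist u c) * ‖deriv g u‖ ≤ d * q :=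
    fun u hu => hmax hu
  have hm : d * q ≤ 48 * ρ := by
    by_contra! hcon
    have hd0 : 0 ≤ d := sub_nonneg.mpr hw
    have hdq : 0 < d * q := by linarith [mul_pos (by norm_num : (0:ℝ) < 48) hρ]
    have hq0 : 0 < q := pos_of_mul_pos_right hdq hd0
    have hdp : 0 < d := pos_of_mul_pos_left hdq hq0.le
    have hin : ∀ u ∈ ball w (d / 2), dist u c ≤ 3 * r / 4 - d / 2 := fun u hu => by
      have := dist_triangle u w c
      rw [mem_ball] at hu
      linarith
    have hbs : ball w (d / 2) ⊆ ball c r := fun u hu => by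
      have := hin u hu
      rw [mem_ball]; linarith
    refine hno (g w) ((ball_subset_ball ?_).trans ((ball_subset_image_of_norm_deriv_le
      (half_pos hdp) (hd.mono hbs) hq0 fun u hu => ?_).trans (image_mono hbs)))
    · linarith
    · have h1 := hin u hu
      have h2 := hmax' u (by rw [mem_closedBall]; linarith)
      have h3 : d / 2 * ‖deriv g u‖ ≤ (3 * r / 4 - dist u c) * ‖deriv g u‖ := by
        gcongr; linarith
      nlinarith
  rw [mem_ball] at hz
  have h1 := hmax' z (by rw [mem_closedBall]; linarith)
  have h2 : r / 4 * ‖deriv g z‖ ≤ (3 * r / 4 - dist z c) * ‖deriv g z‖ := by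
    gcongr; linarith
  rw [le_div_iff₀ hr]
  nlinarith

/-- A holomorphic function on a disc omitting the value `a` either covers a circle about `a`, or
has comparable distances to `a` on the half-size disc. -/
lemma exists_sphere_subset_image_or_norm_sub_le {h : ℂ → ℂ} {a : ℂ} (hr : 0 < r)
    (hd : DifferentiableOn ℂ h (ball c r)) (ha : a ∉ h '' ball c r) :
    (∃ δ > 0, sphere a δ ⊆ h '' ball c r) ∨ ∀ z ∈ ball c (r / 2), ∀ w ∈ ball c (r / 2),
      ‖h z - a‖ ≤ Real.exp 768 * ‖h w - a‖ := by
  obtain ⟨g, hg, hexp⟩ := exists_log_on_ball (hd.sub_const a)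
    (fun z hz => sub_ne_zero.mpr fun he => ha ⟨z, hz, he⟩)
  -- Here g is a logarithm of h - a. A disc of radius 4 > π in its image contains w + i[-π, π],
  -- which exponentiates to a full circle; otherwise Bloch bounds g' by 192 · 4 / r, whence 768.
  by_cases hno : ∀ w, ¬ ball w 4 ⊆ g '' ball c r
  · right
    intro z hz w hw
    have hsub : ball c (r / 2) ⊆ ball c r := ball_subset_ball (by linarith)
    have h1 := (convex_ball c (r / 2)).norm_image_sub_le_of_norm_deriv_le
      (fun u hu => hg.differentiableAt (isOpen_ball.mem_nhds (hsub hu)))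
      (fun u hu => norm_deriv_le_of_forall_not_ball_subset hr (by norm_num) hg hno hu) hw hz
    have h2 : ‖z - w‖ ≤ r := by
      rw [← dist_eq_norm]
      rw [mem_ball] at hz hw
      linarith [dist_triangle_right z w c]
    have h3 : (g z).re - (g w).re ≤ 768 := by
      rw [← Complex.sub_re]
      refine (Complex.re_le_norm _).trans (h1.trans ?_)
      calc 192 * 4 / r * ‖z - w‖ ≤ 192 * 4 / r * r := by gcongr
        _ = 768 := by field_simp; norm_num
    rw [← hexp z (hsub hz), ← hexp w (hsub hw), Complex.norm_exp, Complex.norm_exp,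
      ← Real.exp_add]
    exact Real.exp_le_exp.mpr (by linarith)
  · left
    push Not at hno
    obtain ⟨w, hw⟩ := hno
    refine ⟨Real.exp w.re, Real.exp_pos _, fun p hp => ?_⟩
    rw [mem_sphere_iff_norm, ← Complex.norm_exp] at hp
    set u := (p - a) / Complex.exp w with hu
    have hu1 : ‖u‖ = 1 := by
      rw [hu, norm_div, hp, div_self (norm_ne_zero_iff.mpr (Complex.exp_ne_zero _))]
    have hu0 : u ≠ 0 := norm_ne_zero_iff.mp (by rw [hu1]; exact one_ne_zero)
    have hmem : w + Complex.log u ∈ ball w 4 := by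
      rw [mem_ball, dist_eq_norm, add_sub_cancel_left]
      have := Complex.norm_le_abs_re_add_abs_im (Complex.log u)
      rw [Complex.log_re, hu1, Real.log_one, abs_zero, zero_add, Complex.log_im] at this
      linarith [Complex.abs_arg_le_pi u, Real.pi_lt_four]
    obtain ⟨z, hz, hgz⟩ := hw hmem
    refine ⟨z, hz, ?_⟩
    have h4 := hexp z hz
    rw [hgz, Complex.exp_add, Complex.exp_log hu0, hu,
      mul_div_cancel₀ _ (Complex.exp_ne_zero _)] at h4
    linear_combination -h4

/-- Harnack's inequality for the positive harmonic function `log ‖h‖`. -/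
lemma log_norm_le_of_one_lt_norm {h : ℂ → ℂ} (hr : 0 < r) (hd : DifferentiableOn ℂ h (ball c r))
    (h1 : ∀ z ∈ ball c r, 1 < ‖h z‖) {z : ℂ} (hz : z ∈ ball c (r / 2)) :
    Real.log ‖h z‖ ≤ 3 * Real.log ‖h c‖ := by
  have hsub : ball c (r / 2) ⊆ ball c r := ball_subset_ball (by linarith)
  have hc : c ∈ ball c r := mem_ball_self hr
  obtain ⟨g, hg, hexp⟩ := exists_log_on_ball hd
    (fun z hz => norm_pos_iff.mp (one_pos.trans (h1 z hz)))
  have hlog : ∀ z ∈ ball c r, Real.log ‖h z‖ = (g z).re := fun z hz => by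
    rw [← hexp z hz, Complex.norm_exp, Real.log_exp]
  have hpos : ∀ z ∈ ball c r, 0 < (g z).re := fun z hz => by
    rw [← hlog z hz]; exact Real.log_pos (h1 z hz)
  rw [hlog z (hsub hz), hlog c hc]
  -- (g - g(c))/(g + b) is the Cayley map of the right half-plane sending g(c) to 0. By Schwarz it
  -- is at most 1/2 on the half disc, so |g - g(c)| ≤ 2 Re g(c).
  set b := (starRingEnd ℂ) (g c) with hb
  have hden : ∀ z ∈ ball c r, g z + b ≠ 0 := fun z hz he => by
    have := congrArg Complex.re he
    simp [hb] at this
    linarith [hpos z hz, hpos c hc]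
  have hnum : ∀ z ∈ ball c r, ‖g z - g c‖ ≤ ‖g z + b‖ := fun z hz => by
    rw [← sq_le_sq₀ (norm_nonneg _) (norm_nonneg _), Complex.sq_norm, Complex.sq_norm,
      Complex.normSq_apply, Complex.normSq_apply]
    simp [hb]
    nlinarith [mul_pos (hpos z hz) (hpos c hc)]
  have hφ : DifferentiableOn ℂ (fun z => (g z - g c) / (g z + b)) (ball c r) :=
    (hg.sub_const _).div (hg.add_const _) hden
  have hmaps : MapsTo (fun z => (g z - g c) / (g z + b)) (ball c r)
      (closedBall ((g c - g c) / (g c + b)) 1) := fun z hz => by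
    rw [sub_self, zero_div, mem_closedBall_zero_iff, norm_div]
    exact div_le_one_of_le₀ (hnum z hz) (norm_nonneg _)
  have hs := Complex.dist_le_div_mul_dist_of_mapsTo_ball hφ hmaps (hsub hz)
  have hzc : 1 / r * dist z c ≤ 1 / 2 := by
    calc 1 / r * dist z c ≤ 1 / r * (r / 2) := by
          gcongr; exact (mem_ball.mp hz).le
      _ = 1 / 2 := by field_simp
  have hs2 := hs.trans hzc
  rw [sub_self, zero_div, dist_zero_right, norm_div,
    div_le_iff₀ (norm_pos_iff.mpr (hden z (hsub hz)))] at hs2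
  have h3 : ‖g z + b‖ ≤ ‖g z - g c‖ + 2 * (g c).re := by
    have : g z + b = (g z - g c) + (g c + b) := by ring
    rw [this]
    refine (norm_add_le _ _).trans (add_le_add_right ?_ _)
    rw [hb, Complex.add_conj, Complex.norm_real, Real.norm_eq_abs,
      abs_of_pos (by linarith [hpos c hc])]
  have h4 : (g z).re - (g c).re ≤ ‖g z - g c‖ := by
    rw [← Complex.sub_re]; exact Complex.re_le_norm _
  linarith

end Discs

/-! ### The levels: nested constraints and nonemptiness -/

section Levels

variable {f : ℂ → ℂ} {R : ℝ}

lemma differentiable_iterate (hf : Differentiable ℂ f) (n : ℕ) : Differentiable ℂ f^[n] :=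
  Differentiable.iterate hf n

/-- The substitution n = m + (-L).toNat removes the side condition; one of `L.toNat` and
`(-L).toNat` is zero. -/
lemma mem_level_iff {L : ℤ} {z : ℂ} :
    z ∈ level f R L ↔ ∀ m : ℕ, (maxModulus f)^[m + L.toNat] R ≤ ‖f^[m + (-L).toNat] z‖ := by
  constructor
  · intro h m
    have := h (m + (-L).toNat) (by omega)
    rwa [show (((m + (-L).toNat : ℕ) : ℤ) + L).toNat = m + L.toNat by omega] at this
  · intro h n hn
    have := h (n - (-L).toNat)
    rwa [show n - (-L).toNat + L.toNat = ((n : ℤ) + L).toNat by omega,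
      show n - (-L).toNat + (-L).toNat = n by omega] at this

lemma isClosed_level (hf : Differentiable ℂ f) (R : ℝ) (L : ℤ) : IsClosed (level f R L) := by
  have : level f R L =
      ⋂ m : ℕ, {z | (maxModulus f)^[m + L.toNat] R ≤ ‖f^[m + (-L).toNat] z‖} := by
    ext z; simp [mem_level_iff]
  rw [this]
  exact isClosed_iInter fun m =>
    isClosed_le continuous_const (differentiable_iterate hf _).continuous.norm

lemma norm_iterate_lt (hf : Differentiable ℂ f) (hc : ¬ ∃ c, ∀ z, f z = c) {w : ℂ} {s : ℝ}
    (h : ‖w‖ < s) (k : ℕ) : ‖f^[k] w‖ < (maxModulus f)^[k] s := by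
  induction k with
  | zero => simpa
  | succ k ih =>
    rw [Function.iterate_succ_apply', Function.iterate_succ_apply']
    exact (norm_le_maxModulus hf le_rfl).trans_lt
      (maxModulus_strictMono hf hc (norm_nonneg _) ih)

/-- By the maximum principle each constraint implies the preceding one, so the sets cut out by them
decrease and compactness arguments apply. -/
lemma le_norm_iterate_of_le_norm_iterate_succ (hf : Differentiable ℂ f)
    (hc : ¬ ∃ c, ∀ z, f z = c) {z : ℂ} {m n : ℕ}
    (h : (maxModulus f)^[m + 1] R ≤ ‖f^[n + 1] z‖) : (maxModulus f)^[m] R ≤ ‖f^[n] z‖ := by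
  by_contra! hlt
  have := norm_iterate_lt hf hc hlt 1
  rw [Function.iterate_one, Function.iterate_one, ← Function.iterate_succ_apply' f,
    ← Function.iterate_succ_apply' (maxModulus f)] at this
  exact absurd h (not_le.mpr this)

lemma map_mem_level (hM : ∀ r : ℝ, R ≤ r → r < maxModulus f r) {L : ℤ} {z : ℂ}
    (hz : z ∈ level f R L) : f z ∈ level f R L := by
  rw [mem_level_iff] at hz ⊢
  intro m
  rw [← Function.iterate_succ_apply, Nat.succ_eq_add_one, add_right_comm]
  exact (maxModulus_iterate_le_of_le hM le_rfl (by omega)).trans (hz (m + 1))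

/-- A lower bound for the maximum modulus of a composition, in the spirit of Pólya. -/
lemma maxModulus_le_maxModulus_comp {F : ℂ → ℂ} (hf : Differentiable ℂ f)
    (hF : Differentiable ℂ F) {r ρ : ℝ} (hr : 0 < r) (h0 : ‖f 0‖ ≤ ρ)
    (hρ : (1 + 2 * Real.exp 768) * ρ < maxModulus f (r / 3)) :
    maxModulus F ρ ≤ maxModulus (F ∘ f) r := by
  obtain ⟨a, ha, hFa⟩ := exists_norm_eq_maxModulus hF.continuous ((norm_nonneg _).trans h0)
  have hle : ∀ p ∈ f '' Metric.ball 0 r, ‖F p‖ ≤ maxModulus (F ∘ f) r := by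
    rintro _ ⟨z, hz, rfl⟩
    exact norm_le_maxModulus (hF.comp hf) (f := F ∘ f) (mem_ball_zero_iff.mp hz).le
  rw [← hFa]
  by_cases hmem : a ∈ f '' Metric.ball 0 r
  · exact hle a hmem
  -- If f omits a but covers a circle about it, the maximum principle for F bounds F(a) by its
  -- values on the circle. Otherwise |f - a| is comparable on the half disc, and f(0) keeps M(r/3)
  -- below the assumed bound.
  rcases exists_sphere_subset_image_or_norm_sub_le hr hf.differentiableOn hmem with
    ⟨δ, hδ, hsub⟩ | h
  · refine Complex.norm_le_of_forall_mem_frontier_norm_le (U := Metric.ball a δ)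
      Metric.isBounded_ball hF.diffContOnCl (fun w hw => ?_)
      (subset_closure (Metric.mem_ball_self hδ))
    rw [frontier_ball _ hδ.ne'] at hw
    exact hle w (hsub hw)
  · exfalso
    obtain ⟨z, hz, hfz⟩ := exists_norm_eq_maxModulus hf.continuous (r := r / 3) (by linarith)
    have h1 := h z (by rw [mem_ball_zero_iff]; linarith) 0
      (Metric.mem_ball_self (by linarith))
    have h2 : ‖f z‖ ≤ ‖f z - a‖ + ‖a‖ := by simpa using norm_add_le (f z - a) a
    have h3 : ‖f 0 - a‖ ≤ 2 * ρ := (norm_sub_le _ _).trans (by linarith)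
    have h4 : Real.exp 768 * ‖f 0 - a‖ ≤ Real.exp 768 * (2 * ρ) := by gcongr
    linarith

/-- The factor 6 does not deteriorate with n: the Pólya-type bound is applied with r = 6s and ρ =
6M(s), and its constant is absorbed in passing from M(s) to M(2s). -/
lemma exists_forall_maxModulus_iterate_le (hf : IsTranscendentalEntire f)
    (hM : ∀ r : ℝ, R ≤ r → r < maxModulus f r) :
    ∃ s₀ : ℝ, ∀ n s, s₀ ≤ s → (maxModulus f)^[n] s ≤ maxModulus f^[n] (6 * s) := by
  obtain ⟨s₁, hs₁, h⟩ := eventually_mul_le_maxModulus hf one_lt_two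
    ((1 + 2 * Real.exp 768) * 6 + 1)
  refine ⟨max s₁ R, fun n => ?_⟩
  induction n with
  | zero =>
    intro s hs
    have hs0 : 0 ≤ s := by linarith [(le_max_left _ _).trans hs]
    refine le_trans ?_ (norm_le_maxModulus differentiable_id (f := id)
      (z := ((6 * s : ℝ) : ℂ)) ?_)
    · rw [id, Complex.norm_real, Real.norm_eq_abs, abs_of_nonneg (by linarith)]
      simp; linarith
    · rw [Complex.norm_real, Real.norm_eq_abs, abs_of_nonneg (by linarith)]
  | succ n ih =>
    intro s hs
    have hs1 : s₁ ≤ s := (le_max_left _ _).trans hs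
    have hs0 : 0 < s := by linarith
    have hMs : s < maxModulus f s := hM s ((le_max_right _ _).trans hs)
    rw [Function.iterate_succ_apply, Function.iterate_succ]
    refine (ih (maxModulus f s) (hs.trans hMs.le)).trans ?_
    refine maxModulus_le_maxModulus_comp hf.1 (differentiable_iterate hf.1 n)
      (by linarith) ?_ ?_
    · have : ‖f 0‖ ≤ maxModulus f s := norm_le_maxModulus hf.1 (by simpa using hs0.le)
      linarith
    · rw [show 6 * s / 3 = 2 * s by ring]
      refine lt_of_lt_of_le ?_ (h s hs1)
      linarith

/-- On the circle of radius 6s the sets |f^n| ≥ M^n(s) are compact, nonempty and decreasing; a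
common point works. -/
lemma level_nonempty (hf : IsTranscendentalEntire f) (hR : 0 < R)
    (hM : ∀ r : ℝ, R ≤ r → r < maxModulus f r) (L : ℤ) : (level f R L).Nonempty := by
  obtain ⟨s₀, h⟩ := exists_forall_maxModulus_iterate_le hf hM
  set s := max s₀ ((maxModulus f)^[L.toNat] R) with hs
  have hRs : (maxModulus f)^[L.toNat] R ≤ s := le_max_right _ _
  have hs0 : 0 ≤ s := (maxModulus_iterate_nonneg hR.le _).trans hRs
  have hcl : ∀ n, IsClosed {z | (maxModulus f)^[n] s ≤ ‖f^[n] z‖} := fun n =>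
    isClosed_le continuous_const (differentiable_iterate hf.1 _).continuous.norm
  obtain ⟨z, hz⟩ := IsCompact.nonempty_iInter_of_sequence_nonempty_isCompact_isClosed
    (fun n => Metric.sphere (0 : ℂ) (6 * s) ∩ {z | (maxModulus f)^[n] s ≤ ‖f^[n] z‖})
    (fun n z hz => ⟨hz.1, le_norm_iterate_of_le_norm_iterate_succ hf.1 hf.not_const hz.2⟩)
    (fun n => by
      obtain ⟨z, hz, hz'⟩ := exists_norm_eq_maxModulus (f := f^[n])
        (differentiable_iterate hf.1 _).continuous (r := 6 * s) (by linarith)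
      exact ⟨z, by simpa using hz, by
        simpa [hz'] using h n s (le_max_left _ _)⟩)
    ((isCompact_sphere _ _).inter_right (hcl 0))
    (fun n => Metric.isClosed_sphere.inter (hcl n))
  rw [mem_iInter] at hz
  refine ⟨z, mem_level_iff.mpr fun m => ?_⟩
  refine le_trans ?_ (hz (m + (-L).toNat)).2
  rw [Function.iterate_add_apply]
  refine (maxModulus_iterate_mono hf.1 (maxModulus_iterate_nonneg hR.le _) hRs m).trans ?_
  rw [add_comm, Function.iterate_add_apply]
  rcases Nat.eq_zero_or_pos (-L).toNat with h0 | h0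
  · simp [h0]
  · have hRs' : R ≤ s := (le_maxModulus_iterate hM le_rfl _).trans hRs
    rw [← Function.iterate_add_apply]
    exact maxModulus_iterate_le_of_le hM hRs' (by omega)

end Levels

/-! ### Separating bounded components from infinity -/

section BoundaryBumping

/-- A point of a closed plane set whose component is bounded is separated from `∞` by an open
set with frontier off the closed set. -/
lemma exists_isOpen_disjoint_frontier {E : Set ℂ} (hE : IsClosed E) {z : ℂ} (hz : z ∈ E)
    (hb : Bornology.IsBounded (connectedComponentIn E z)) :
    ∃ V, IsOpen V ∧ Bornology.IsBounded V ∧ z ∈ V ∧ Disjoint (frontier V) E := by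
  obtain ⟨r, hr⟩ := hb.subset_ball 0
  have hzr : z ∈ Metric.ball (0 : ℂ) r := hr (mem_connectedComponentIn hz)
  set Y := E ∩ Metric.closedBall (0 : ℂ) r with hY
  have hYc : IsCompact Y := (isCompact_closedBall (0 : ℂ) r).inter_left hE
  have : CompactSpace Y := isCompact_iff_compactSpace.mp hYc
  have hzY : z ∈ Y := ⟨hz, Metric.ball_subset_closedBall hzr⟩
  have hcomp : connectedComponent (⟨z, hzY⟩ : Y) ⊆ {y : Y | (y : ℂ) ∈ Metric.ball (0 : ℂ) r} := by
    intro y hy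
    refine hr ((isPreconnected_connectedComponent.image _
      continuous_subtype_val.continuousOn).subset_connectedComponentIn
      ⟨⟨z, hzY⟩, mem_connectedComponent, rfl⟩ ?_ ⟨y, hy, rfl⟩)
    rintro _ ⟨w, -, rfl⟩
    exact w.2.1
  -- In a compact Hausdorff space a component is an intersection of clopen sets, so by compactness
  -- one of them already lies in the open ball.
  rw [connectedComponent_eq_iInter_isClopen] at hcomp
  have : Nonempty { s : Set Y // IsClopen s ∧ (⟨z, hzY⟩ : Y) ∈ s } :=
    ⟨⟨univ, isClopen_univ, mem_univ _⟩⟩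
  obtain ⟨⟨Z₀, hZ₀, hzZ₀⟩, hZ₀r⟩ := exists_subset_nhds_of_compactSpace
    (V := fun s : { s : Set Y // IsClopen s ∧ (⟨z, hzY⟩ : Y) ∈ s } => (s : Set Y))
    (fun s t => ⟨⟨s ∩ t, s.2.1.inter t.2.1, s.2.2, t.2.2⟩, inter_subset_left,
      inter_subset_right⟩)
    (fun s => s.2.1.1)
    (fun x hx => (Metric.isOpen_ball.preimage continuous_subtype_val).mem_nhds (hcomp hx))
  obtain ⟨O, hO, hOZ⟩ := isOpen_induced_iff.mp hZ₀.2
  set Z : Set ℂ := (↑) '' Z₀ with hZ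
  have hZc : IsCompact Z := hZ₀.1.isCompact.image continuous_subtype_val
  -- The clopen piece of the truncation avoids the bounding circle, so it is relatively open in E
  -- itself.
  have hZeq : Z = E ∩ (O ∩ Metric.ball 0 r) := by
    ext w
    constructor
    · rintro ⟨y, hy, rfl⟩
      have hyO : y ∈ (↑) ⁻¹' O := hOZ ▸ hy
      exact ⟨y.2.1, hyO, hZ₀r hy⟩
    · rintro ⟨h1, h2, h3⟩
      refine ⟨⟨w, h1, Metric.ball_subset_closedBall h3⟩, ?_, rfl⟩
      rw [← hOZ]
      exact h2
  have hEZ : IsClosed (E \ Z) := by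
    rw [hZeq, sdiff_self_inter]
    exact hE.sdiff (hO.inter Metric.isOpen_ball)
  obtain ⟨δ, hδ, hsub⟩ := hZc.exists_cthickening_subset_open hEZ.isOpen_compl
    (fun w hw h => h.2 hw)
  refine ⟨Metric.thickening δ Z, Metric.isOpen_thickening, hZc.isBounded.thickening,
    Metric.self_subset_thickening hδ _ ⟨⟨z, hzY⟩, hzZ₀, rfl⟩,
    disjoint_left.mpr fun w hw hwE => ?_⟩
  rw [Metric.isOpen_thickening.frontier_eq] at hw
  exact hsub (Metric.closure_thickening_subset_cthickening _ _ hw.1)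
    ⟨hwE, fun hwZ => hw.2 (Metric.self_subset_thickening hδ _ hwZ)⟩

end BoundaryBumping

/-- Fence off a bounded component by an open V whose frontier misses the level. Applied to each
iterate, the maximum principle makes the constraints cut nested nonempty compact sets on the
frontier of V, so the level meets it after all. -/
lemma not_isBounded_connectedComponentIn_level {f : ℂ → ℂ} {R : ℝ}
    (hf : IsTranscendentalEntire f) {L : ℤ} {z : ℂ} (hz : z ∈ level f R L) :
    ¬ Bornology.IsBounded (connectedComponentIn (level f R L) z) := by
  intro hb
  obtain ⟨V, hVo, hVb, hzV, hdis⟩ :=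
    exists_isOpen_disjoint_frontier (isClosed_level hf.1 R L) hz hb
  have hcl : ∀ m, IsClosed {z | (maxModulus f)^[m + L.toNat] R ≤ ‖f^[m + (-L).toNat] z‖} :=
    fun m => isClosed_le continuous_const (differentiable_iterate hf.1 _).continuous.norm
  have hfc : IsCompact (frontier V) := Metric.isCompact_of_isClosed_isBounded isClosed_frontier
    (hVb.closure.subset frontier_subset_closure)
  have hne : ∀ m, (frontier V ∩
      {z | (maxModulus f)^[m + L.toNat] R ≤ ‖f^[m + (-L).toNat] z‖}).Nonempty := by
    intro m
    obtain ⟨w, hw, hmax⟩ := Complex.exists_mem_frontier_isMaxOn_norm hVb ⟨z, hzV⟩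
      ((differentiable_iterate hf.1 (m + (-L).toNat)).diffContOnCl)
    exact ⟨w, hw, (mem_level_iff.mp hz m).trans (hmax (subset_closure hzV))⟩
  obtain ⟨w, hw⟩ := IsCompact.nonempty_iInter_of_sequence_nonempty_isCompact_isClosed
    (fun m => frontier V ∩
      {z | (maxModulus f)^[m + L.toNat] R ≤ ‖f^[m + (-L).toNat] z‖})
    (fun m w hw => ⟨hw.1, le_norm_iterate_of_le_norm_iterate_succ hf.1 hf.not_const (R := R)
      (m := m + L.toNat) (n := m + (-L).toNat) (by
        have h := hw.2
        rwa [mem_ofPred_eq, add_right_comm m 1, add_right_comm m 1] at h)⟩)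
    hne (hfc.inter_right (hcl 0)) (fun m => isClosed_frontier.inter (hcl m))
  rw [mem_iInter] at hw
  exact disjoint_left.mp hdis (hw 0).1 (mem_level_iff.mpr fun m => (hw m).2)

/-! ### Multiple connectivity and separation in the plane -/

section PlaneTopology

lemma inter_frontier_nonempty_of_isPreconnected {S V : Set ℂ} (hS : IsPreconnected S)
    (h1 : (S ∩ V).Nonempty) (h2 : (S ∩ Vᶜ).Nonempty) : (S ∩ frontier V).Nonempty := by
  by_contra hne
  rw [not_nonempty_iff_eq_empty] at hne
  have hnf : ∀ x ∈ S, x ∉ frontier V := fun x hx hf => by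
    have : x ∈ S ∩ frontier V := ⟨hx, hf⟩
    rwa [hne] at this
  obtain ⟨x, hx, hxV⟩ := h1
  obtain ⟨y, hy, hyV⟩ := h2
  have hint : ∀ x ∈ S, x ∈ V → x ∈ interior V := fun x hx hxV => by
    by_contra h
    exact hnf x hx ⟨subset_closure hxV, h⟩
  have hcl : ∀ x ∈ S, x ∉ V → x ∈ (closure V)ᶜ := fun x hx hxV h =>
    hnf x hx ⟨h, fun h' => hxV (interior_subset h')⟩
  obtain ⟨w, -, hw1, hw2⟩ := hS (interior V) (closure V)ᶜ isOpen_interior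
    isClosed_closure.isOpen_compl (fun z hz => by
      by_cases h : z ∈ V
      · exact Or.inl (hint z hz h)
      · exact Or.inr (hcl z hz h)) ⟨x, hx, hint x hx hxV⟩ ⟨y, hy, hcl y hy hyV⟩
  exact hw2 (subset_closure (interior_subset hw1))

/-- A domain containing the frontier of a bounded open set, but not the whole of this set, is
multiply connected. -/
lemma isMultiplyConnected_of_frontier_subset {U V : Set ℂ} (hVo : IsOpen V)
    (hVb : Bornology.IsBounded V) (hfr : frontier V ⊆ U) {x : ℂ} (hx : x ∈ V) (hxU : x ∉ U) :
    IsMultiplyConnected U := by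
  intro hcon
  have hcomp : IsCompact (closure V) := hVb.isCompact_closure
  obtain ⟨w, -, ⟨v, hv, rfl⟩, hw2⟩ := hcon.isPreconnected ((↑) '' V) ((↑) '' closure V)ᶜ
    (OnePoint.isOpen_image_coe.mpr hVo)
    (OnePoint.isOpen_compl_image_coe.mpr ⟨isClosed_closure, hcomp⟩)
    (fun p hp => by
      induction p using OnePoint.rec with
      | infty => exact Or.inr OnePoint.infty_notMem_image_coe
      | coe p =>
        by_cases h : p ∈ V
        · exact Or.inl ⟨p, h, rfl⟩
        · refine Or.inr fun ⟨q, hq, hqp⟩ => hp ⟨p, hfr ?_, rfl⟩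
          rw [OnePoint.coe_injective hqp] at hq
          exact ⟨hq, by rwa [hVo.interior_eq]⟩)
    ⟨x, fun ⟨q, hq, hqx⟩ => hxU (OnePoint.coe_injective hqx ▸ hq), x, hx, rfl⟩
    ⟨OnePoint.infty, OnePoint.infty_notMem_image_coe, OnePoint.infty_notMem_image_coe⟩
  exact hw2 ⟨v, subset_closure hv, rfl⟩

/-- A multiply connected open set surrounds a compact part of its complement, which has no point
in common with the closure of the rest of the complement. -/
lemma IsMultiplyConnected.exists_compact {U : Set ℂ} (hU : IsOpen U)
    (hm : IsMultiplyConnected U) : ∃ A B : Set ℂ, IsCompact A ∧ A.Nonempty ∧ IsClosed B ∧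
      Disjoint A B ∧ A ∪ B = Uᶜ := by
  set S : Set (OnePoint ℂ) := ((↑) '' U)ᶜ with hS
  have hinf : OnePoint.infty ∈ S := OnePoint.infty_notMem_image_coe
  have hScl : IsClosed S := (OnePoint.isOpen_image_coe.mpr hU).isClosed_compl
  have hpre : ¬ IsPreconnected S := fun h => hm ⟨⟨_, hinf⟩, h⟩
  -- The labels are chosen so that ∞ lies in O₂; then S \ O₂ misses ∞ and is compact in the plane.
  have key : ∃ O₁ O₂ : Set (OnePoint ℂ), IsOpen O₁ ∧ IsOpen O₂ ∧ S ⊆ O₁ ∪ O₂ ∧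
      (S ∩ O₁).Nonempty ∧ ¬ (S ∩ (O₁ ∩ O₂)).Nonempty ∧ OnePoint.infty ∈ O₂ := by
    simp only [IsPreconnected, not_forall] at hpre
    obtain ⟨O₁, O₂, h1, h2, h3, h4, h5, h6⟩ := hpre
    rcases h3 hinf with h | h
    · exact ⟨O₂, O₁, h2, h1, by rwa [union_comm], h5, by rwa [inter_comm O₂], h⟩
    · exact ⟨O₁, O₂, h1, h2, h3, h4, h6, h⟩
  obtain ⟨O₁, O₂, h1, h2, h3, ⟨p, hpS, hp1⟩, h6, h7⟩ := key
  have hnot : ∀ q ∈ S, q ∈ O₁ → q ∉ O₂ := fun q hq hq1 hq2 => h6 ⟨q, hq, hq1, hq2⟩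
  have hmem : ∀ z : ℂ, (z : OnePoint ℂ) ∈ S ↔ z ∉ U := fun z => by
    rw [hS, mem_compl_iff, not_iff_not]
    exact ⟨fun ⟨q, hq, hqz⟩ => OnePoint.coe_injective hqz ▸ hq, fun h => ⟨z, h, rfl⟩⟩
  have hA : IsClosed (S \ O₂) := hScl.sdiff h2
  have hcont : Continuous ((↑) : ℂ → OnePoint ℂ) := OnePoint.continuous_coe
  refine ⟨(↑) ⁻¹' (S \ O₂), (↑) ⁻¹' (S \ O₁), ?_, ?_, (hScl.sdiff h1).preimage hcont, ?_, ?_⟩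
  · exact ((OnePoint.isClosed_iff_of_notMem (fun h => h.2 h7)).mp hA).2
  · induction p using OnePoint.rec with
    | infty => exact absurd h7 (hnot _ hpS hp1)
    | coe p => exact ⟨p, hpS, hnot _ hpS hp1⟩
  · refine disjoint_left.mpr fun z hz hz' => ?_
    rcases h3 hz.1 with h | h
    · exact hz'.2 h
    · exact hz.2 h
  · ext z
    simp only [mem_union, mem_preimage, Set.mem_sdiff, mem_compl_iff, hmem]
    constructor
    · rintro (h | h) <;> exact h.1
    · intro h
      by_cases hz : (z : OnePoint ℂ) ∈ O₂
      · exact Or.inr ⟨h, fun h' => hnot _ ((hmem z).mpr h) h' hz⟩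
      · exact Or.inl ⟨h, hz⟩

end PlaneTopology

/-! ### Fatou set and Fatou components -/

section FatouSet

variable {f : ℂ → ℂ}

lemma IsNormalFamilyOn.mono {F : ℕ → ℂ → ℂ} {D D' : Set ℂ} (h : IsNormalFamilyOn F D)
    (hD : D' ⊆ D) : IsNormalFamilyOn F D' := by
  intro s
  obtain ⟨φ, hφ, ⟨g, hg⟩ | hinf⟩ := h s
  · exact ⟨φ, hφ, Or.inl ⟨g, hg.mono hD⟩⟩
  · exact ⟨φ, hφ, Or.inr fun K hK => hinf K (hK.trans hD)⟩

lemma isOpen_fatouSet : IsOpen (fatouSet f) := by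
  rw [Metric.isOpen_iff]
  rintro z ⟨r, hr, hN⟩
  refine ⟨r, hr, fun w hw => ⟨r - dist w z, sub_pos.mpr hw, hN.mono ?_⟩⟩
  exact Metric.ball_subset_ball' (by linarith)

lemma isClosed_juliaSet : IsClosed (juliaSet f) := isOpen_fatouSet.isClosed_compl

lemma IsComponentOf.isOpen {U : Set ℂ} (hU : IsComponentOf U (fatouSet f)) : IsOpen U := by
  obtain ⟨z, -, rfl⟩ := hU
  exact isOpen_fatouSet.connectedComponentIn

lemma IsComponentOf.subset {C S : Set ℂ} (hC : IsComponentOf C S) : C ⊆ S := by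
  obtain ⟨z, -, rfl⟩ := hC
  exact connectedComponentIn_subset _ _

lemma IsComponentOf.isPreconnected {C S : Set ℂ} (hC : IsComponentOf C S) :
    IsPreconnected C := by
  obtain ⟨z, -, rfl⟩ := hC
  exact isPreconnected_connectedComponentIn

lemma IsComponentOf.subset_of_inter_nonempty {C S T : Set ℂ} (hC : IsComponentOf C S)
    (hT : IsPreconnected T) (hTS : T ⊆ S) (hne : (T ∩ C).Nonempty) : T ⊆ C := by
  obtain ⟨z, -, rfl⟩ := hC
  obtain ⟨x, hxT, hx⟩ := hne
  rw [connectedComponentIn_eq hx]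
  exact hT.subset_connectedComponentIn hxT hTS

lemma isOpenMap_of_not_const (hf : Differentiable ℂ f) (hc : ¬ ∃ c, ∀ z, f z = c) :
    IsOpenMap f :=
  (AnalyticOnNhd.is_constant_or_isOpenMap fun z _ => hf.analyticAt z).resolve_left hc

lemma isOpenMap_iterate (hf : Differentiable ℂ f) (hc : ¬ ∃ c, ∀ z, f z = c) (n : ℕ) :
    IsOpenMap f^[n] := by
  induction n with
  | zero => exact IsOpenMap.id
  | succ n ih => exact ih.comp (isOpenMap_of_not_const hf hc)

/-- By openness f has a right inverse p, not necessarily continuous, from a disc about f(z) into a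
compact disc about z. Uniform behaviour of f^(n+1) on the latter transfers through p to f^n. -/
lemma map_mem_fatouSet (hf : Differentiable ℂ f) (hc : ¬ ∃ c, ∀ z, f z = c) {z : ℂ}
    (hz : z ∈ fatouSet f) : f z ∈ fatouSet f := by
  obtain ⟨r, hr, hN⟩ := hz
  have hsub : Metric.closedBall z (r / 2) ⊆ Metric.ball z r :=
    Metric.closedBall_subset_ball (by linarith)
  obtain ⟨ρ, hρ, hball⟩ := Metric.isOpen_iff.mp
    (isOpenMap_of_not_const hf hc _ (Metric.isOpen_ball (x := z) (ε := r / 2))) (f z)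
    ⟨z, Metric.mem_ball_self (by linarith), rfl⟩
  replace hball : ∀ u ∈ Metric.ball (f z) ρ, ∃ p ∈ Metric.ball z (r / 2), f p = u :=
    fun u hu => hball hu
  choose! p hp hfp using hball
  have hp' : ∀ u ∈ Metric.ball (f z) ρ, p u ∈ Metric.closedBall z (r / 2) := fun u hu =>
    Metric.ball_subset_closedBall (hp u hu)
  refine ⟨ρ, hρ, fun s => ?_⟩
  obtain ⟨φ, hφ, ⟨g, hg⟩ | hinf⟩ := hN fun k => s k + 1
  · refine ⟨φ, hφ, Or.inl ⟨fun u => g (p u), ?_⟩⟩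
    have hu := (tendstoLocallyUniformlyOn_iff_forall_isCompact Metric.isOpen_ball).mp hg _ hsub
      (isCompact_closedBall _ _)
    refine TendstoUniformlyOn.tendstoLocallyUniformlyOn fun u hu' => ?_
    filter_upwards [hu u hu'] with k hk w hw
    have := hk (p w) (hp' w hw)
    rwa [Function.iterate_succ_apply, hfp w hw] at this
  · refine ⟨φ, hφ, Or.inr fun K hK _ B => ?_⟩
    filter_upwards [hinf _ hsub (isCompact_closedBall _ _) B] with k hk w hw
    have := hk (p w) (hp' w (hK hw))
    rwa [Function.iterate_succ_apply, hfp w (hK hw)] at this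

lemma iterate_mem_fatouSet (hf : Differentiable ℂ f) (hc : ¬ ∃ c, ∀ z, f z = c) {z : ℂ}
    (hz : z ∈ fatouSet f) (n : ℕ) : f^[n] z ∈ fatouSet f := by
  induction n with
  | zero => exact hz
  | succ n ih => rw [Function.iterate_succ_apply']; exact map_mem_fatouSet hf hc ih

/-- A multiply connected Fatou component surrounds a point of the Julia set. -/
lemma exists_isOpen_frontier_subset {U : Set ℂ} (hU : IsComponentOf U (fatouSet f))
    (hm : IsMultiplyConnected U) : ∃ G, IsOpen G ∧ Bornology.IsBounded G ∧ frontier G ⊆ U ∧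
      (G ∩ juliaSet f).Nonempty := by
  obtain ⟨A, B, hA, hAne, hB, hAB, hABU⟩ := hm.exists_compact hU.isOpen
  obtain ⟨δ, hδ, hsub⟩ := hA.exists_cthickening_subset_open hB.isOpen_compl
    hAB.subset_compl_right
  have hAG : A ⊆ Metric.thickening δ A := Metric.self_subset_thickening hδ _
  refine ⟨Metric.thickening δ A, Metric.isOpen_thickening, hA.isBounded.thickening,
    fun w hw => ?_, ?_⟩
  · rw [Metric.isOpen_thickening.frontier_eq] at hw
    by_contra hwU
    rcases (hABU ▸ hwU : w ∈ A ∪ B) with h | h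
    · exact hw.2 (hAG h)
    · exact hsub (Metric.closure_thickening_subset_cthickening _ _ hw.1) h
  -- A frontier point of A is in J: if not, its Fatou component misses U, so lies in A ∪ B, and
  -- removing B leaves a neighbourhood inside A.
  · obtain ⟨a, ha⟩ := nonempty_frontier_iff.mpr
      ⟨hAne, fun h => noncompact_univ ℂ (h ▸ hA)⟩
    have haA : a ∈ A := hA.isClosed.frontier_subset ha
    refine ⟨a, hAG haA, fun haF => ha.2 ?_⟩
    have haU : a ∉ U := by
      have : a ∈ Uᶜ := hABU ▸ Or.inl haA
      exact this
    set V := connectedComponentIn (fatouSet f) a with hV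
    have haV : a ∈ V := mem_connectedComponentIn haF
    have hdis : ∀ v ∈ V, v ∈ A ∪ B := fun v hv => by
      rw [hABU]
      intro hvU
      exact haU (hU.subset_of_inter_nonempty isPreconnected_connectedComponentIn
        (connectedComponentIn_subset _ _) ⟨v, hv, hvU⟩ haV)
    refine mem_interior.mpr ⟨V ∩ Bᶜ, fun v hv => (hdis v hv.1).resolve_right hv.2,
      isOpen_fatouSet.connectedComponentIn.inter hB.isOpen_compl, haV,
      disjoint_left.mp hAB haA⟩

end FatouSet

/-! ### Unicoherence and connected frontiers -/

section Unicoherence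

lemma eq_of_forall_eq_intCast {S : Set ℂ} (hS : IsPreconnected S) {k : ℂ → ℝ}
    (hk : ContinuousOn k S) (hint : ∀ z ∈ S, ∃ n : ℤ, k z = n) {x y : ℂ} (hx : x ∈ S)
    (hy : y ∈ S) : k x = k y := by
  have key : ∀ x ∈ S, ∀ y ∈ S, ¬ k x < k y := by
    intro x hx y hy hlt
    obtain ⟨m, hm⟩ := hint x hx
    obtain ⟨n, hn⟩ := hint y hy
    rw [hm, hn] at hlt
    have hmn : m + 1 ≤ n := by exact_mod_cast hlt
    have hmn' : (m : ℝ) + 1 ≤ n := by exact_mod_cast hmn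
    obtain ⟨w, hw, hkw⟩ := hS.intermediate_value hx hy hk
      (show (m : ℝ) + 1 / 2 ∈ Icc (k x) (k y) by rw [hm, hn]; constructor <;> linarith)
    obtain ⟨l, hl⟩ := hint w hw
    rw [hl] at hkw
    have h1 : m < l := by exact_mod_cast (by linarith : (m : ℝ) < l)
    have h2 : l < m + 1 := by exact_mod_cast (by linarith : (l : ℝ) < m + 1)
    omega
  exact le_antisymm (not_lt.mp (key y hy x hx)) (not_lt.mp (key x hx y hy))

lemma sub_eq_sub_of_exp_eq {S : Set ℂ} (hS : IsPreconnected S) {ψ v : ℂ → ℂ}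
    (hψ : ContinuousOn ψ S) (hv : ContinuousOn v S)
    (h : ∀ z ∈ S, Complex.exp (ψ z) = Complex.exp (v z)) {x y : ℂ} (hx : x ∈ S) (hy : y ∈ S) :
    (ψ x - v x).im = (ψ y - v y).im := by
  have hpi : (2 * Real.pi) ≠ 0 := by positivity
  have := eq_of_forall_eq_intCast hS (k := fun z => (ψ z - v z).im / (2 * Real.pi))
    ((Complex.continuous_im.comp_continuousOn (hψ.sub hv)).div_const _) (fun z hz => by
      obtain ⟨n, hn⟩ := Complex.exp_eq_exp_iff_exists_int.mp (h z hz)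
      refine ⟨n, ?_⟩
      rw [hn]
      simp) hx hy
  field_simp at this
  exact this

/-- The plane is unicoherent. -/
theorem isPreconnected_inter_of_union_eq_univ {A B : Set ℂ} (hA : IsClosed A) (hB : IsClosed B)
    (hAc : IsPreconnected A) (hBc : IsPreconnected B) (hAB : A ∪ B = univ) :
    IsPreconnected (A ∩ B) := by
  rw [isPreconnected_closed_iff]
  intro t t' ht ht' hsub ⟨p, hp, hpt⟩ ⟨q, hq, hqt'⟩
  by_contra hne
  have hdis : Disjoint (A ∩ B ∩ t) (A ∩ B ∩ t') := disjoint_left.mpr fun x hx hx' =>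
    hne ⟨x, hx.1, hx.2, hx'.2⟩
  -- The functions e^(iπu) on A and e^(-iπu) on B agree where u is 0 or 1, so they glue to a
  -- zero-free function with a continuous logarithm on the plane. Its imaginary part would change
  -- from p to q by π through A and by -π through B.
  obtain ⟨u, hu0, hu1, -⟩ := exists_continuous_zero_one_of_isClosed
    ((hA.inter hB).inter ht) ((hA.inter hB).inter ht') hdis
  set v : ℂ → ℂ := fun z => ((u z * Real.pi : ℝ) : ℂ) * Complex.I with hv
  have hvc : Continuous v := by fun_prop
  have hval : ∀ z ∈ A ∩ B, Complex.exp (v z) = Complex.exp (-v z) := by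
    intro z hz
    rcases hsub hz with h | h
    · have : u z = 0 := hu0 ⟨hz, h⟩
      simp [hv, this]
    · have : u z = 1 := hu1 ⟨hz, h⟩
      simp [hv, this, Complex.exp_neg, Complex.exp_pi_mul_I]
  classical
  set h : ℂ → ℂ := fun z => if z ∈ A then Complex.exp (v z) else Complex.exp (-v z) with hh
  have hhA : ∀ z ∈ A, h z = Complex.exp (v z) := fun z hz => if_pos hz
  have hhB : ∀ z ∈ B, h z = Complex.exp (-v z) := fun z hz => by
    by_cases hzA : z ∈ A
    · rw [hhA z hzA, hval z ⟨hzA, hz⟩]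
    · exact if_neg hzA
  have hcont : Continuous h := by
    rw [← continuousOn_univ, ← hAB]
    refine ContinuousOn.union_of_isClosed ?_ ?_ hA hB
    · exact (by fun_prop : Continuous fun z => Complex.exp (v z)).continuousOn.congr hhA
    · exact (by fun_prop : Continuous fun z => Complex.exp (-v z)).continuousOn.congr hhB
  have hh0 : ∀ z, h z ≠ 0 := fun z => by
    simp only [hh]; split_ifs <;> exact Complex.exp_ne_zero _
  obtain ⟨ψ, ⟨-, hψ⟩, -⟩ := Complex.isCoveringMapOn_exp.existsUnique_continuousMap_lifts
    (⟨h, hcont⟩ : C(ℂ, ℂ)) (a₀ := 0) (e₀ := Complex.log (h 0)) (Complex.exp_log (hh0 0))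
    (fun z => hh0 z)
  have hexp : ∀ z, Complex.exp (ψ z) = h z := fun z => congrFun hψ z
  have e1 := sub_eq_sub_of_exp_eq hAc ψ.continuous.continuousOn hvc.continuousOn
    (fun z hz => (hexp z).trans (hhA z hz)) hp.1 hq.1
  have e2 := sub_eq_sub_of_exp_eq hBc ψ.continuous.continuousOn hvc.neg.continuousOn
    (fun z hz => (hexp z).trans (hhB z hz)) hp.2 hq.2
  have hup : u p = 0 := hu0 ⟨hp, hpt⟩
  have huq : u q = 1 := hu1 ⟨hq, hqt'⟩
  simp [hv, hup, huq] at e1 e2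
  linarith [Real.pi_pos]

/-- Otherwise a ∪ u and v ∩ b would disconnect the plane. -/
lemma isPreconnected_compl_connectedComponentIn_aux {C u v a b : Set ℂ}
    (hu : IsOpen u) (hv : IsOpen v) (huv : Cᶜ ⊆ u ∪ v) (hne : ¬ (Cᶜ ∩ (u ∩ v)).Nonempty)
    (ha : IsOpen a) (hb : IsOpen b) (hab : C ∪ (Cᶜ ∩ v) ⊆ a ∪ b)
    (hne' : (C ∪ (Cᶜ ∩ v)) ∩ (a ∩ b) = ∅) (hCa : C ⊆ a) (hC : C.Nonempty) :
    Cᶜ ∩ v ⊆ a := by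
  have hnot : ∀ x, x ∈ C ∪ (Cᶜ ∩ v) → x ∈ a → x ∉ b := fun x hx hxa hxb => by
    have : x ∈ (C ∪ (Cᶜ ∩ v)) ∩ (a ∩ b) := ⟨hx, hxa, hxb⟩
    rwa [hne'] at this
  have hbC : ∀ x ∈ b, x ∉ C := fun x hxb hxC => hnot x (Or.inl hxC) (hCa hxC) hxb
  have hdis : ∀ x ∈ a ∪ u, x ∉ v ∩ b := by
    rintro x (hx | hx) ⟨hxv, hxb⟩
    · exact hnot x (Or.inr ⟨hbC x hxb, hxv⟩) hx hxb
    · exact hne ⟨x, hbC x hxb, hx, hxv⟩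
  intro x hx
  rcases hab (Or.inr hx) with h | h
  · exact h
  exfalso
  obtain ⟨y, hy⟩ := hC
  obtain ⟨w, -, hw1, hw2⟩ := (isPreconnected_univ : IsPreconnected (univ : Set ℂ))
    (a ∪ u) (v ∩ b) (ha.union hu) (hv.inter hb) (fun w _ => by
      by_cases hwC : w ∈ C
      · exact Or.inl (Or.inl (hCa hwC))
      · rcases huv hwC with h | h
        · exact Or.inl (Or.inr h)
        · rcases hab (Or.inr ⟨hwC, h⟩) with h' | h'
          · exact Or.inl (Or.inl h')
          · exact Or.inr ⟨h, h'⟩)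
    ⟨y, mem_univ _, Or.inl (hCa hy)⟩ ⟨x, mem_univ _, hx.2, h⟩
  exact hdis w hw1 hw2

/-- If the complement of C splits with S on one side, C together with the other side is connected
and misses S, so maximality of C makes that side empty. -/
lemma isPreconnected_compl_connectedComponentIn {S : Set ℂ} (hS : IsPreconnected S) {x : ℂ}
    (hx : x ∉ S) : IsPreconnected (connectedComponentIn Sᶜ x)ᶜ := by
  set C := connectedComponentIn Sᶜ x with hCdef
  have hxC : x ∈ C := mem_connectedComponentIn hx
  have hSC : S ⊆ Cᶜ := fun s hs hsC => connectedComponentIn_subset _ _ hsC hs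
  have key : ∀ u v : Set ℂ, IsOpen u → IsOpen v → Cᶜ ⊆ u ∪ v → Cᶜ ∩ (u ∩ v) = ∅ → S ⊆ u →
      Cᶜ ⊆ u := by
    intro u v hu hv huv hne hSu
    rw [← not_nonempty_iff_eq_empty] at hne
    have hconn : IsPreconnected (C ∪ (Cᶜ ∩ v)) := by
      rw [isPreconnected_iff_subset_of_disjoint]
      intro a b ha hb hab hne'
      rcases (isPreconnected_iff_subset_of_disjoint.mp
        (isPreconnected_connectedComponentIn : IsPreconnected C)) a b ha hb
        (subset_union_left.trans hab)
        (subset_empty_iff.mp ((inter_subset_inter_left _ subset_union_left).trans hne'.subset))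
        with h | h
      · exact Or.inl (union_subset h (isPreconnected_compl_connectedComponentIn_aux hu hv huv
          hne ha hb hab hne' h ⟨x, hxC⟩))
      · exact Or.inr (union_subset h (isPreconnected_compl_connectedComponentIn_aux hu hv huv
          hne hb ha (by rwa [union_comm b]) (by rwa [inter_comm b]) h ⟨x, hxC⟩))
    have hsub : C ∪ (Cᶜ ∩ v) ⊆ C := hconn.subset_connectedComponentIn (Or.inl hxC)
      (union_subset (connectedComponentIn_subset _ _)
        (fun w hw hwS => hne ⟨w, hw.1, hSu hwS, hw.2⟩))
    intro w hw
    exact (huv hw).resolve_right fun hwv => hw (hsub (Or.inr ⟨hw, hwv⟩))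
  rw [isPreconnected_iff_subset_of_disjoint]
  intro u v hu hv huv hne
  rcases (isPreconnected_iff_subset_of_disjoint.mp hS) u v hu hv (hSC.trans huv)
    (subset_empty_iff.mp ((inter_subset_inter_left _ hSC).trans hne.subset)) with h | h
  · exact Or.inl (key u v hu hv huv hne h)
  · exact Or.inr (key v u hv hu (by rwa [union_comm]) (by rwa [inter_comm v]) h)

lemma isPreconnected_compl_closedBall {r : ℝ} (hr : 0 < r) :
    IsPreconnected (Metric.closedBall (0 : ℂ) r)ᶜ := by
  have : (Metric.closedBall (0 : ℂ) r)ᶜ = Complex.exp '' {w | Real.log r < w.re} := by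
    ext z
    rw [mem_compl_iff, mem_closedBall_zero_iff, not_le]
    constructor
    · intro hz
      have hz0 : z ≠ 0 := norm_pos_iff.mp (hr.trans hz)
      exact ⟨Complex.log z, by
        rw [mem_ofPred_eq, Complex.log_re]; exact Real.log_lt_log hr hz, Complex.exp_log hz0⟩
    · rintro ⟨w, hw, rfl⟩
      rw [Complex.norm_exp]
      exact (Real.log_lt_iff_lt_exp hr).mp hw
  rw [this]
  exact (convex_halfSpace_re_gt _).isPreconnected.image _ Complex.continuous_exp.continuousOn

lemma isClosed_connectedComponentIn {E : Set ℂ} (hE : IsClosed E) (z : ℂ) :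
    IsClosed (connectedComponentIn E z) := by
  by_cases hz : z ∈ E
  · refine isClosed_of_closure_subset ?_
    exact isPreconnected_connectedComponentIn.closure.subset_connectedComponentIn
      (subset_closure (mem_connectedComponentIn hz))
      (closure_minimal (connectedComponentIn_subset _ _) hE)
  · rw [connectedComponentIn_eq_empty hz]; exact isClosed_empty

/-- Every point of a bounded open set lies in a bounded open set whose frontier is connected and
is part of the original frontier. -/
lemma exists_isPreconnected_frontier {V : Set ℂ} (hVo : IsOpen V)
    (hVb : Bornology.IsBounded V) {z : ℂ} (hz : z ∈ V) :
    ∃ W, IsOpen W ∧ Bornology.IsBounded W ∧ z ∈ W ∧ frontier W ⊆ frontier V ∧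
      IsPreconnected (frontier W) := by
  set V₁ := connectedComponentIn V z with hV₁
  have hzV₁ : z ∈ V₁ := mem_connectedComponentIn hz
  have hV₁V : V₁ ⊆ V := connectedComponentIn_subset _ _
  have hV₁o : IsOpen V₁ := hVo.connectedComponentIn
  have hV₁c : IsPreconnected V₁ := isPreconnected_connectedComponentIn
  have hfr₁ : frontier V₁ ⊆ frontier V := by
    intro w hw
    rw [hV₁o.frontier_eq] at hw
    rw [hVo.frontier_eq]
    refine ⟨closure_mono hV₁V hw.1, fun hwV => hw.2 ?_⟩
    obtain ⟨y, hy, hyV₁⟩ := mem_closure_iff.mp hw.1 _ hVo.connectedComponentIn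
      (mem_connectedComponentIn hwV)
    rw [hV₁, connectedComponentIn_eq hyV₁, ← connectedComponentIn_eq hy]
    exact mem_connectedComponentIn hwV
  obtain ⟨r, hr0, hr⟩ := (hVb.subset hV₁V).subset_closedBall_lt 0 0
  have hx : ((r + 1 : ℝ) : ℂ) ∈ (Metric.closedBall (0 : ℂ) r)ᶜ := by
    rw [mem_compl_iff, mem_closedBall_zero_iff, Complex.norm_real, Real.norm_eq_abs,
      abs_of_pos (by linarith)]
    linarith
  set x : ℂ := ((r + 1 : ℝ) : ℂ) with hxdef
  have hout : (Metric.closedBall (0 : ℂ) r)ᶜ ⊆ V₁ᶜ := compl_subset_compl.mpr hr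
  -- B is the unbounded complementary component, so Bᶜ is V₁ with its holes filled. B and the
  -- closure of Bᶜ are closed, connected and cover the plane; they meet in the frontier.
  set B := connectedComponentIn V₁ᶜ x with hB
  have hBout : (Metric.closedBall (0 : ℂ) r)ᶜ ⊆ B :=
    (isPreconnected_compl_closedBall hr0).subset_connectedComponentIn hx hout
  have hBV₁ : B ⊆ V₁ᶜ := connectedComponentIn_subset _ _
  have hBcl : IsClosed B := isClosed_connectedComponentIn hV₁o.isClosed_compl x
  have hBc : IsPreconnected B := isPreconnected_connectedComponentIn
  refine ⟨Bᶜ, hBcl.isOpen_compl, Metric.isBounded_closedBall.subset (compl_subset_comm.mp hBout),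
    fun h => hBV₁ h hzV₁, ?_, ?_⟩
  · refine Subset.trans ?_ hfr₁
    rw [frontier_compl]
    intro b hb
    have hbB : b ∈ B := hBcl.frontier_subset hb
    rw [hV₁o.frontier_eq]
    refine ⟨?_, hBV₁ hbB⟩
    by_contra hbcl
    obtain ⟨ε, hε, hball⟩ := Metric.isOpen_iff.mp isClosed_closure.isOpen_compl b hbcl
    refine hb.2 (mem_interior.mpr ⟨Metric.ball b ε, ?_, Metric.isOpen_ball,
      Metric.mem_ball_self hε⟩)
    rw [hB, connectedComponentIn_eq hbB]
    exact (convex_ball b ε).isPreconnected.subset_connectedComponentIn (Metric.mem_ball_self hε)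
      (hball.trans (compl_subset_compl.mpr subset_closure))
  · rw [frontier_eq_closure_inter_closure, compl_compl, hBcl.closure_eq]
    refine isPreconnected_inter_of_union_eq_univ isClosed_closure hBcl
      (isPreconnected_compl_connectedComponentIn hV₁c (hout hx)).closure hBc ?_
    exact eq_univ_of_forall fun w => by
      by_cases hw : w ∈ B
      · exact Or.inr hw
      · exact Or.inl (subset_closure hw)

end Unicoherence

/-! ### Escape and surrounding discs by images of Fatou components -/

section Escaping

variable {f : ℂ → ℂ}

lemma exists_strictMono_norm_le_of_not_tendsto {t : ℕ → ℕ} {x : ℂ} {F : ℕ → ℂ → ℂ}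
    (h : ¬ Tendsto (fun k => ‖F (t k) x‖) atTop atTop) :
    ∃ B, ∃ ψ : ℕ → ℕ, StrictMono ψ ∧ ∀ k, ‖F (t (ψ k)) x‖ ≤ B := by
  rw [tendsto_atTop] at h
  push Not at h
  obtain ⟨B, hB⟩ := h
  obtain ⟨ψ, hψ, hψB⟩ := extraction_of_frequently_atTop hB
  exact ⟨B, ψ, hψ, fun k => (hψB k).le⟩

/-- Within a normal family, escape to `∞` at one point forces locally uniform escape. -/
lemma IsNormalFamilyOn.eventually_forall_lt {F : ℕ → ℂ → ℂ} {D : Set ℂ}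
    (hN : IsNormalFamilyOn F D) {t : ℕ → ℕ} {x : ℂ} (hx : x ∈ D)
    (ht : Tendsto (fun k => ‖F (t k) x‖) atTop atTop) {K : Set ℂ} (hK : K ⊆ D)
    (hKc : IsCompact K) (B : ℝ) : ∀ᶠ k in atTop, ∀ z ∈ K, B < ‖F (t k) z‖ := by
  by_contra hcon
  rw [not_eventually] at hcon
  obtain ⟨ψ, hψ, hψB⟩ := extraction_of_frequently_atTop hcon
  obtain ⟨φ, hφ, ⟨g, hg⟩ | hinf⟩ := hN fun k => t (ψ k)
  · have h1 := (hg.tendsto_at hx).norm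
    have h2 : Tendsto (fun k => ‖F (t (ψ (φ k))) x‖) atTop atTop :=
      ht.comp (hψ.tendsto_atTop.comp hφ.tendsto_atTop)
    exact not_tendsto_nhds_of_tendsto_atTop h2 _ h1
  · obtain ⟨k, hk⟩ := (hinf K hK hKc B).exists
    exact hψB _ hk

lemma tendsto_norm_iterate_of_isPreconnected {U : Set ℂ} (hU : IsPreconnected U)
    (hUF : U ⊆ fatouSet f) {t : ℕ → ℕ} {x y : ℂ} (hx : x ∈ U) (hy : y ∈ U)
    (ht : Tendsto (fun k => ‖f^[t k] x‖) atTop atTop) :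
    Tendsto (fun k => ‖f^[t k] y‖) atTop atTop := by
  have key := hU.induction₂ (fun x y => Tendsto (fun k => ‖f^[t k] x‖) atTop atTop ↔
    Tendsto (fun k => ‖f^[t k] y‖) atTop atTop) (fun z hz => ?_)
    (fun _ _ _ _ _ _ h1 h2 => h1.trans h2) (fun _ _ _ _ h => h.symm) hx hy
  · exact key.mp ht
  · obtain ⟨r, hr, hN⟩ := hUF hz
    have hball : ∀ u ∈ Metric.ball z r, ∀ v ∈ Metric.ball z r,
        Tendsto (fun k => ‖f^[t k] u‖) atTop atTop →
        Tendsto (fun k => ‖f^[t k] v‖) atTop atTop := fun u hu v hv h =>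
      tendsto_atTop.mpr fun B => (hN.eventually_forall_lt hu h (singleton_subset_iff.mpr hv)
        isCompact_singleton B).mono fun k hk => (hk v rfl).le
    filter_upwards [mem_nhdsWithin_of_mem_nhds (Metric.ball_mem_nhds z hr)] with w hw
    exact ⟨hball z (Metric.mem_ball_self hr) w hw, hball w hw z (Metric.mem_ball_self hr)⟩

lemma eventually_forall_lt_norm_iterate {U : Set ℂ} (hU : IsPreconnected U)
    (hUF : U ⊆ fatouSet f) {t : ℕ → ℕ} {x : ℂ} (hx : x ∈ U)
    (ht : Tendsto (fun k => ‖f^[t k] x‖) atTop atTop) {Q : Set ℂ} (hQ : IsCompact Q)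
    (hQU : Q ⊆ U) (B : ℝ) : ∀ᶠ k in atTop, ∀ z ∈ Q, B < ‖f^[t k] z‖ := by
  refine hQ.induction_on (p := fun S => ∀ᶠ k in atTop, ∀ z ∈ S, B < ‖f^[t k] z‖)
    (by simp) (fun S T hST hT => hT.mono fun k hk z hz => hk z (hST hz))
    (fun S T hS hT => (hS.and hT).mono fun k hk z hz => hz.elim (hk.1 z) (hk.2 z))
    (fun q hq => ?_)
  obtain ⟨r, hr, hN⟩ := hUF (hQU hq)
  exact ⟨Metric.closedBall q (r / 2),
    mem_nhdsWithin_of_mem_nhds (Metric.closedBall_mem_nhds q (by linarith)),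
    hN.eventually_forall_lt (Metric.mem_ball_self hr)
      (tendsto_norm_iterate_of_isPreconnected hU hUF hx (hQU hq) ht)
      (Metric.closedBall_subset_ball (by linarith)) (isCompact_closedBall _ _) B⟩

lemma uniformCauchySeqOn_comp_strictMono {F : ℕ → ℂ → ℂ} {S : Set ℂ}
    (h : UniformCauchySeqOn F atTop S) {φ : ℕ → ℕ} (hφ : StrictMono φ) :
    UniformCauchySeqOn (fun k => F (φ k)) atTop S := by
  rw [Metric.uniformCauchySeqOn_iff] at h ⊢
  intro ε hε
  obtain ⟨N, hN⟩ := h ε hε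
  exact ⟨N, fun m hm n hn => hN _ (hm.trans (hφ.id_le m)) _ (hn.trans (hφ.id_le n))⟩

/-- Boundedness at p rules out the limit ∞ on every disc in U, since escape spreads over U. Finitely
many discs cover Q; quantifying over `t` lets subsequences be extracted one disc after another. -/
lemma exists_uniformCauchySeqOn_iterate {U : Set ℂ} (hU : IsPreconnected U)
    (hUF : U ⊆ fatouSet f) {t : ℕ → ℕ} {p : ℂ} (hp : p ∈ U) {B : ℝ}
    (ht : ∀ k, ‖f^[t k] p‖ ≤ B) {Q : Set ℂ} (hQ : IsCompact Q) (hQU : Q ⊆ U) :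
    ∃ φ : ℕ → ℕ, StrictMono φ ∧ UniformCauchySeqOn (fun k => f^[t (φ k)]) atTop Q := by
  have key : ∀ t : ℕ → ℕ, (∀ k, ‖f^[t k] p‖ ≤ B) → ∃ φ : ℕ → ℕ, StrictMono φ ∧
      UniformCauchySeqOn (fun k => f^[t (φ k)]) atTop Q := by
    refine hQ.induction_on (p := fun S => ∀ t : ℕ → ℕ, (∀ k, ‖f^[t k] p‖ ≤ B) →
      ∃ φ : ℕ → ℕ, StrictMono φ ∧ UniformCauchySeqOn (fun k => f^[t (φ k)]) atTop S)
      ?_ ?_ ?_ ?_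
    · exact fun t _ => ⟨id, strictMono_id, fun u _ => by simp⟩
    · intro S T hST hT t ht
      obtain ⟨φ, hφ, h⟩ := hT t ht
      exact ⟨φ, hφ, h.mono hST⟩
    · intro S T hS hT t ht
      obtain ⟨φ, hφ, h⟩ := hS t ht
      obtain ⟨ψ, hψ, h'⟩ := hT (fun k => t (φ k)) fun k => ht _
      refine ⟨φ ∘ ψ, hφ.comp hψ, fun u hu => ?_⟩
      filter_upwards [uniformCauchySeqOn_comp_strictMono h hψ u hu, h' u hu] with m h1 h2 x hx
      exact hx.elim (h1 x) (h2 x)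
    · intro q hq
      obtain ⟨r, hr, hN⟩ := hUF (hQU hq)
      have hsub : Metric.closedBall q (r / 2) ⊆ Metric.ball q r :=
        Metric.closedBall_subset_ball (by linarith)
      refine ⟨Metric.closedBall q (r / 2),
        mem_nhdsWithin_of_mem_nhds (Metric.closedBall_mem_nhds q (by linarith)),
        fun t ht => ?_⟩
      obtain ⟨φ, hφ, ⟨g, hg⟩ | hinf⟩ := hN t
      · exact ⟨φ, hφ, ((tendstoLocallyUniformlyOn_iff_forall_isCompact Metric.isOpen_ball).mp
          hg _ hsub (isCompact_closedBall _ _)).uniformCauchySeqOn⟩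
      · exfalso
        have h1 : Tendsto (fun k => ‖f^[t (φ k)] q‖) atTop atTop :=
          tendsto_atTop.mpr fun C => (hinf {q}
            (singleton_subset_iff.mpr (Metric.mem_ball_self hr)) isCompact_singleton C).mono
            fun k hk => (hk q rfl).le
        have h2 := tendsto_norm_iterate_of_isPreconnected hU hUF (t := fun k => t (φ k))
          (hQU hq) hp h1
        obtain ⟨k, hk⟩ := (h2.eventually_gt_atTop B).exists
        exact absurd (ht (φ k)) (not_le.mpr hk)
  exact key t ht

lemma uniformCauchySeqOn_of_frontier {F : ℕ → ℂ → ℂ} (hF : ∀ k, Differentiable ℂ (F k))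
    {G : Set ℂ} (hG : Bornology.IsBounded G)
    (h : UniformCauchySeqOn F atTop (frontier G)) : UniformCauchySeqOn F atTop G := by
  rw [Metric.uniformCauchySeqOn_iff] at h ⊢
  intro ε hε
  obtain ⟨N, hN⟩ := h (ε / 2) (by linarith)
  refine ⟨N, fun m hm n hn z hz => ?_⟩
  have := Complex.norm_le_of_forall_mem_frontier_norm_le hG
    ((hF m).sub (hF n)).diffContOnCl (C := ε / 2) (fun w hw => by
      have := hN m hm n hn w hw
      rw [dist_eq_norm] at this
      exact this.le) (subset_closure hz)
  rw [dist_eq_norm]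
  exact lt_of_le_of_lt this (by linarith)

lemma exists_tendstoUniformlyOn {F : ℕ → ℂ → ℂ} {S : Set ℂ}
    (h : UniformCauchySeqOn F atTop S) : ∃ g, TendstoUniformlyOn F g atTop S := by
  have hlim : ∀ z, ∃ w, z ∈ S → Tendsto (fun k => F k z) atTop (𝓝 w) := fun z => by
    by_cases hz : z ∈ S
    · obtain ⟨w, hw⟩ := cauchySeq_tendsto_of_complete (h.cauchySeq hz)
      exact ⟨w, fun _ => hw⟩
    · exact ⟨0, fun h => absurd h hz⟩
  choose g hg using hlim
  exact ⟨g, h.tendstoUniformlyOn_of_tendsto fun z hz => hg z hz⟩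

/-- If the frontier of a bounded open set meeting the Julia set lies in a single Fatou component,
then some image of it surrounds any given disc. -/
lemma exists_iterate_forall_frontier_lt (hf : Differentiable ℂ f) {U G : Set ℂ}
    (hU : IsPreconnected U) (hUF : U ⊆ fatouSet f) (hGo : IsOpen G)
    (hGb : Bornology.IsBounded G) (hGU : frontier G ⊆ U) {a : ℂ} (haG : a ∈ G)
    (haJ : a ∈ juliaSet f) (R₀ : ℝ) :
    ∃ m, 0 ∈ f^[m] '' G ∧ ∀ w ∈ frontier G, R₀ < ‖f^[m] w‖ := by
  by_contra! hcon
  refine haJ ?_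
  obtain ⟨ρ, hρ, hball⟩ := Metric.isOpen_iff.mp hGo a haG
  obtain ⟨p, hp, -⟩ := Complex.exists_mem_frontier_isMaxOn_norm hGb ⟨a, haG⟩ hf.diffContOnCl
  have hfc : IsCompact (frontier G) := Metric.isCompact_of_isClosed_isBounded isClosed_frontier
    (hGb.closure.subset frontier_subset_closure)
  refine ⟨ρ, hρ, fun s => ?_⟩
  -- Escape at p is uniform on the frontier and, by `hcon`, eventually excludes zeros in G, so the
  -- maximum principle for the reciprocal gives escape on G. Without escape, a subsequence is
  -- uniformly Cauchy on the frontier, hence on G. Either way a would be in F.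
  by_cases ht : Tendsto (fun k => ‖f^[s k] p‖) atTop atTop
  · refine ⟨id, strictMono_id, Or.inr fun K hK _ B => ?_⟩
    filter_upwards [eventually_forall_lt_norm_iterate hU hUF (hGU hp) ht hfc hGU
      (max R₀ (|B| + 1))] with k hk z hz
    have h0 : 0 ∉ f^[s k] '' G := fun h0 => by
      obtain ⟨w, hw, hle⟩ := hcon (s k) h0
      exact absurd ((le_max_left _ _).trans_lt (hk w hw)) (not_lt.mpr hle)
    have hBp : 0 < |B| + 1 := by positivity
    have h0' : ∀ w ∈ closure G, f^[s k] w ≠ 0 := fun w hw h => by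
      by_cases hwG : w ∈ G
      · exact h0 ⟨w, hwG, h⟩
      · have := (le_max_right _ _).trans_lt (hk w (hGo.frontier_eq ▸ ⟨hw, hwG⟩))
        rw [h, norm_zero] at this
        linarith
    have hdiff : DiffContOnCl ℂ (fun w => (f^[s k] w)⁻¹) G :=
      (differentiable_iterate hf (s k)).diffContOnCl.inv h0'
    have hzG : z ∈ G := hball (hK hz)
    have hle := Complex.norm_le_of_forall_mem_frontier_norm_le hGb hdiff
      (C := (|B| + 1)⁻¹) (fun w hw => by
        rw [norm_inv]
        exact inv_anti₀ hBp ((le_max_right _ _).trans (hk w hw).le)) (subset_closure hzG)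
    rw [norm_inv, inv_le_inv₀ (norm_pos_iff.mpr (h0' z (subset_closure hzG))) hBp] at hle
    have := le_abs_self B
    simp only [id]
    linarith
  · obtain ⟨B, ψ, hψ, hB⟩ := exists_strictMono_norm_le_of_not_tendsto (F := fun n => f^[n]) ht
    obtain ⟨φ, hφ, hc⟩ := exists_uniformCauchySeqOn_iterate hU hUF (t := fun k => s (ψ k))
      (hGU hp) hB hfc hGU
    obtain ⟨g, hg⟩ := exists_tendstoUniformlyOn (uniformCauchySeqOn_of_frontier
      (fun k => differentiable_iterate hf _) hGb hc)
    exact ⟨ψ ∘ φ, hψ.comp hφ, Or.inl ⟨g, (hg.mono hball).tendstoLocallyUniformlyOn⟩⟩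

/-- Some image of a multiply connected Fatou component meets every unbounded connected set which
meets a given disc. -/
lemma IsMultiplyConnected.exists_forall_inter_nonempty (hf : Differentiable ℂ f)
    (hc : ¬ ∃ c, ∀ z, f z = c) {U : Set ℂ} (hU : IsComponentOf U (fatouSet f))
    (hm : IsMultiplyConnected U) {R₀ : ℝ} (hR₀ : 0 < R₀) :
    ∃ m, ∀ S, IsPreconnected S → ¬ Bornology.IsBounded S →
      (S ∩ Metric.ball 0 R₀).Nonempty → (S ∩ f^[m] '' U).Nonempty := by
  obtain ⟨G, hGo, hGb, hGU, a, haG, haJ⟩ := exists_isOpen_frontier_subset hU hm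
  obtain ⟨m, h0, hfr⟩ := exists_iterate_forall_frontier_lt hf hU.isPreconnected hU.subset hGo
    hGb hGU haG haJ R₀
  have hcont : Continuous f^[m] := (differentiable_iterate hf m).continuous
  have hcomp : IsCompact (f^[m] '' closure G) := hGb.isCompact_closure.image hcont
  have hWo : IsOpen (f^[m] '' G) := isOpenMap_iterate hf hc m _ hGo
  have hWb : Bornology.IsBounded (f^[m] '' G) :=
    hcomp.isBounded.subset (image_mono subset_closure)
  have hWfr : frontier (f^[m] '' G) ⊆ f^[m] '' frontier G := by
    intro w hw
    rw [hWo.frontier_eq] at hw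
    obtain ⟨v, hv, rfl⟩ := closure_minimal (image_mono subset_closure) hcomp.isClosed hw.1
    refine ⟨v, ?_, rfl⟩
    rw [hGo.frontier_eq]
    exact ⟨hv, fun h => hw.2 ⟨v, h, rfl⟩⟩
  have hball : Metric.ball 0 R₀ ⊆ f^[m] '' G := by
    by_contra hsub
    obtain ⟨x, hx, hxW⟩ := not_subset.mp hsub
    obtain ⟨w, hw, hw'⟩ := inter_frontier_nonempty_of_isPreconnected
      (convex_ball (0 : ℂ) R₀).isPreconnected ⟨0, Metric.mem_ball_self hR₀, h0⟩ ⟨x, hx, hxW⟩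
    obtain ⟨v, hv, rfl⟩ := hWfr hw'
    exact absurd (hfr v hv) (not_lt.mpr (mem_ball_zero_iff.mp hw).le)
  refine ⟨m, fun S hS hSb ⟨x, hxS, hx⟩ => ?_⟩
  obtain ⟨y, hy, hyW⟩ := not_subset.mp fun h => hSb (hWb.subset h)
  obtain ⟨w, hw, hw'⟩ := inter_frontier_nonempty_of_isPreconnected hS
    ⟨x, hxS, hball hx⟩ ⟨y, hy, hyW⟩
  exact ⟨w, hw, (image_mono hGU) (hWfr hw')⟩

end Escaping

/-! ### Comparable escape rates within a Fatou component -/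

section Harnack

variable {f : ℂ → ℂ}

/-- Orbits of points of a Fatou component which escape do so at comparable rates. -/
lemma exists_eventually_log_norm_iterate_le (hf : Differentiable ℂ f) {U : Set ℂ}
    (hU : IsPreconnected U) (hUF : U ⊆ fatouSet f) {x y : ℂ} (hx : x ∈ U) (hy : y ∈ U)
    (hesc : Tendsto (fun n => ‖f^[n] x‖) atTop atTop) :
    ∃ C : ℝ, 0 ≤ C ∧ ∀ᶠ n in atTop, Real.log ‖f^[n] y‖ ≤ C * Real.log ‖f^[n] x‖ := by
  have hescU : ∀ z ∈ U, Tendsto (fun n => ‖f^[n] z‖) atTop atTop := fun z hz =>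
    tendsto_norm_iterate_of_isPreconnected hU hUF (t := fun n => n) hx hz hesc
  have key := hU.induction₂ (fun x y => ∃ C : ℝ, 0 ≤ C ∧ ∀ᶠ n in atTop,
    Real.log ‖f^[n] y‖ ≤ C * Real.log ‖f^[n] x‖ ∧ Real.log ‖f^[n] x‖ ≤ C * Real.log ‖f^[n] y‖)
    (fun z hz => ?_) (fun u v w _ _ _ h1 h2 => ?_)
    (fun u v _ _ ⟨C, hC, h⟩ => ⟨C, hC, h.mono fun n hn => hn.symm⟩) hx hy
  · obtain ⟨C, hC, h⟩ := key
    exact ⟨C, hC, h.mono fun n hn => hn.1⟩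
  · obtain ⟨r, hr, hN⟩ := hUF hz
    have hev := hN.eventually_forall_lt (t := fun n => n) (Metric.mem_ball_self hr)
      (hescU z hz) (K := Metric.closedBall z (r / 2))
      (Metric.closedBall_subset_ball (by linarith)) (isCompact_closedBall _ _) 1
    -- With w within r/8 of z, Harnack applies in both directions: on the disc of radius r/2 about
    -- z, and on that of radius r/4 about w.
    filter_upwards [mem_nhdsWithin_of_mem_nhds
      (Metric.ball_mem_nhds z (ε := r / 8) (by linarith))] with w hw
    rw [Metric.mem_ball] at hw
    have hd := dist_comm w z
    refine ⟨3, by norm_num, hev.mono fun n hn => ⟨?_, ?_⟩⟩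
    · refine log_norm_le_of_one_lt_norm (c := z) (r := r / 2) (by linarith)
        (differentiable_iterate hf n).differentiableOn
        (fun v hv => hn v (Metric.ball_subset_closedBall hv)) ?_
      rw [Metric.mem_ball]; linarith
    · refine log_norm_le_of_one_lt_norm (c := w) (r := r / 4) (by linarith)
        (differentiable_iterate hf n).differentiableOn
        (fun v hv => hn v ?_) ?_
      · rw [Metric.mem_ball] at hv
        rw [Metric.mem_closedBall]
        linarith [dist_triangle v w z]
      · rw [Metric.mem_ball]; linarith
  · obtain ⟨C, hC, h1⟩ := h1
    obtain ⟨D, hD, h2⟩ := h2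
    refine ⟨C * D, by positivity, (h1.and h2).mono fun n hn => ⟨?_, ?_⟩⟩
    · calc _ ≤ D * Real.log ‖f^[n] v‖ := hn.2.1
        _ ≤ D * (C * Real.log ‖f^[n] u‖) := by gcongr; exact hn.1.1
        _ = _ := by ring
    · calc _ ≤ C * Real.log ‖f^[n] v‖ := hn.1.2
        _ ≤ C * (D * Real.log ‖f^[n] w‖) := by gcongr; exact hn.2.2
        _ = _ := by ring

/-- A fast escaping point and its image never lie in the same Fatou component. -/
lemma not_mem_of_map_mem {R : ℝ} (hf : IsTranscendentalEntire f) (hR : 0 < R)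
    (hM : ∀ r : ℝ, R ≤ r → r < maxModulus f r) {L : ℤ} {U : Set ℂ}
    (hU : IsPreconnected U) (hUF : U ⊆ fatouSet f) {z : ℂ} (hz : z ∈ level f R L)
    (hzU : z ∈ U) : f z ∉ U := by
  intro hfz
  rw [mem_level_iff] at hz
  set p := L.toNat
  set q := (-L).toNat
  have hMlim := tendsto_maxModulus_iterate hf.1 hR hM
  have hesc : Tendsto (fun n => ‖f^[n] z‖) atTop atTop := by
    rw [← tendsto_add_atTop_iff_nat q]
    exact tendsto_atTop_mono hz ((tendsto_add_atTop_iff_nat p).mpr hMlim)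
  obtain ⟨C, hC, hev⟩ := exists_eventually_log_norm_iterate_le hf.1 hU hUF hzU hfz hesc
  -- Since M(r) ≥ r^k, log M^n(R) eventually grows at least like (2C + 2)^n, against at most C^n for
  -- log|f^n(z)|. Comparing with (C + 1)^n leaves 2^n and avoids dividing by C = 0.
  obtain ⟨k, hk⟩ := exists_nat_ge (2 * C + 2)
  obtain ⟨N, hN⟩ := eventually_atTop.mp (((tendsto_add_atTop_nat q).eventually hev).and
    (((tendsto_add_atTop_nat p).eventually (hMlim.eventually
      (eventually_pow_le_maxModulus hf k))).and
    ((tendsto_add_atTop_nat p).eventually (hMlim.eventually_ge_atTop 2))))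
  have hb : ∀ j : ℕ, (2 * C + 2) ^ j * Real.log ((maxModulus f)^[N + p] R) ≤
      Real.log ((maxModulus f)^[N + j + p] R) := by
    intro j
    induction j with
    | zero => simp
    | succ j ih =>
      obtain ⟨-, h2, h3⟩ := hN (N + j) (by omega)
      have hpos : 0 ≤ Real.log ((maxModulus f)^[N + j + p] R) := Real.log_nonneg (by linarith)
      have h4 := Real.log_le_log (pow_pos (by linarith) k) h2
      rw [Real.log_pow, ← Function.iterate_succ_apply' (maxModulus f)] at h4
      rw [show N + (j + 1) + p = (N + j + p).succ by omega]
      refine le_trans ?_ h4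
      rw [pow_succ]
      nlinarith
  have ha : ∀ j : ℕ, Real.log ‖f^[N + j + q] z‖ ≤ C ^ j * Real.log ‖f^[N + q] z‖ := by
    intro j
    induction j with
    | zero => simp
    | succ j ih =>
      obtain ⟨h1, -, -⟩ := hN (N + j) (by omega)
      rw [← Function.iterate_succ_apply f] at h1
      rw [show N + (j + 1) + q = (N + j + q).succ by omega, pow_succ]
      nlinarith
  have hb0 : 0 < Real.log ((maxModulus f)^[N + p] R) :=
    Real.log_pos (by linarith [(hN N le_rfl).2.2])
  have hab : ∀ j : ℕ, 2 ^ j * Real.log ((maxModulus f)^[N + p] R) ≤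
      Real.log ‖f^[N + q] z‖ := by
    intro j
    have h1 : Real.log ((maxModulus f)^[N + j + p] R) ≤ Real.log ‖f^[N + j + q] z‖ :=
      Real.log_le_log (by linarith [(hN (N + j) (by omega)).2.2]) (hz (N + j))
    have ha0 : 0 ≤ Real.log ‖f^[N + q] z‖ :=
      hb0.le.trans (Real.log_le_log (by linarith [(hN N le_rfl).2.2]) (hz N))
    have hC1 : 0 < (C + 1) ^ j := by positivity
    have h2 : C ^ j ≤ (C + 1) ^ j := by gcongr; linarith
    have h3 : (2 * C + 2) ^ j = (C + 1) ^ j * 2 ^ j := by rw [← mul_pow]; ring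
    have h4 := ((hb j).trans h1).trans ((ha j).trans (mul_le_mul_of_nonneg_right h2 ha0))
    rw [h3, mul_assoc] at h4
    exact le_of_mul_le_mul_left h4 hC1
  have hlim : Tendsto (fun j : ℕ => (2 : ℝ) ^ j * Real.log ((maxModulus f)^[N + p] R))
      atTop atTop := (tendsto_pow_atTop_atTop_of_one_lt one_lt_two).atTop_mul_const hb0
  obtain ⟨j, hj⟩ := (hlim.eventually_gt_atTop (Real.log ‖f^[N + q] z‖)).exists
  exact absurd (hab j) (not_le.mpr hj)

end Harnack

/-! ### The two implications -/

variable {f : ℂ → ℂ} {R : ℝ}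

/-- Growth with exponent 2 at least squares the ratio y/x > 1 at each late step, whereas y ≤ c + Kx
with x → ∞ keeps it bounded. -/
lemma not_isBounded_of_ratio_growth (hf : IsTranscendentalEntire f) {x y : ℕ → ℝ} {c K : ℝ}
    (hK : 0 < K) (hxy : ∀ k, x k < y k) (hx : ∀ k, x (k + 1) ≤ maxModulus f (x k))
    (hy : ∀ k, y (k + 1) = maxModulus f (y k)) (hlim : Tendsto y atTop atTop)
    (hle : ∀ k, y k ≤ c + K * x k) : False := by
  obtain ⟨s₀, hs₀, hgr⟩ := exists_forall_pow_mul_maxModulus_le hf 2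
  have hxlim : Tendsto x atTop atTop := by
    have h1 : Tendsto (fun k => (y k + -c) / K) atTop atTop :=
      (tendsto_atTop_add_const_right _ _ hlim).atTop_div_const hK
    refine tendsto_atTop_mono (fun k => ?_) h1
    rw [div_le_iff₀ hK]
    linarith [hle k]
  obtain ⟨N, hN⟩ := eventually_atTop.mp (hxlim.eventually_ge_atTop (max s₀ c))
  have hxs : ∀ j, s₀ ≤ x (N + j) := fun j => (le_max_left _ _).trans (hN _ (by omega))
  have hx0 : ∀ j, 0 < x (N + j) := fun j => by linarith [hxs j]
  have hρ1 : 1 < y N / x N := (one_lt_div (hx0 0)).mpr (hxy N)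
  have hρ : ∀ j, (y N / x N) ^ (j + 1) ≤ y (N + j) / x (N + j) := by
    intro j
    induction j with
    | zero => simp
    | succ j ih =>
      have h1 := hgr _ _ (hxs j) (hxy (N + j)).le
      have h2 : (y (N + j) / x (N + j)) ^ 2 * x (N + (j + 1)) ≤ y (N + (j + 1)) := by
        rw [← add_assoc, hy]
        exact (mul_le_mul_of_nonneg_left (hx _) (sq_nonneg _)).trans h1
      have h3 : (y (N + j) / x (N + j)) ^ 2 ≤ y (N + (j + 1)) / x (N + (j + 1)) :=
        (le_div_iff₀ (hx0 _)).mpr h2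
      have h4 : 1 ≤ (y N / x N) ^ j := one_le_pow₀ hρ1.le
      refine le_trans ?_ ((pow_le_pow_left₀ (by positivity) ih 2).trans h3)
      rw [← pow_mul]
      exact pow_le_pow_right₀ hρ1.le (by omega)
  obtain ⟨j, hj⟩ := ((tendsto_pow_atTop_atTop_of_one_lt hρ1).eventually_gt_atTop
    (K + 1)).exists
  have h5 : y (N + j) / x (N + j) ≤ K + 1 := by
    rw [div_le_iff₀ (hx0 j)]
    have hcx : c ≤ x (N + j) := (le_max_right _ _).trans (hN _ (by omega))
    linarith [hle (N + j)]
  have h6 := pow_le_pow_right₀ hρ1.le (Nat.le_add_right j 1)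
  linarith [hρ j]

/-- The iterates map the disc into F and so omit a. A covered circle about a would lie in a Fatou
component surrounding a; the remaining alternative is the comparison, with a constant independent of
n. -/
lemma exists_norm_iterate_sub_le (hf : IsTranscendentalEntire f)
    (hmc : ¬ ∃ U : Set ℂ, IsComponentOf U (fatouSet f) ∧ IsMultiplyConnected U) {a : ℂ}
    (ha : a ∈ juliaSet f) {z : ℂ} {r : ℝ} (hr : 0 < r) (hF : Metric.ball z r ⊆ fatouSet f)
    {u w : ℂ} (hu : u ∈ Metric.ball z (r / 2)) (hw : w ∈ Metric.ball z (r / 2)) (n : ℕ) :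
    ‖f^[n] u - a‖ ≤ Real.exp 768 * ‖f^[n] w - a‖ := by
  have himg : f^[n] '' Metric.ball z r ⊆ fatouSet f := by
    rintro _ ⟨v, hv, rfl⟩
    exact iterate_mem_fatouSet hf.1 hf.not_const (hF hv) n
  rcases exists_sphere_subset_image_or_norm_sub_le hr
    (differentiable_iterate hf.1 n).differentiableOn (fun h => ha (himg h)) with
    ⟨δ, hδ, hsub⟩ | h
  · exfalso
    have hconn : IsConnected (Metric.sphere a δ) :=
      isConnected_sphere (by rw [Complex.rank_real_complex]; norm_num) a hδ.le
    obtain ⟨b, hb⟩ := hconn.nonempty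
    have hbF : b ∈ fatouSet f := himg (hsub hb)
    refine hmc ⟨connectedComponentIn (fatouSet f) b, ⟨b, hbF, rfl⟩,
      isMultiplyConnected_of_frontier_subset Metric.isOpen_ball Metric.isBounded_ball ?_
        (Metric.mem_ball_self hδ) fun h => ha (connectedComponentIn_subset _ _ h)⟩
    rw [frontier_ball _ hδ.ne']
    exact hconn.isPreconnected.subset_connectedComponentIn hb (hsub.trans himg)
  · exact h u hu w hw

/-- A point w failing one constraint stays strictly below the iterated maximum modulus, while
comparison with z keeps it within a bounded factor: `not_isBounded_of_ratio_growth` forbids this. -/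
lemma ball_subset_level (hf : IsTranscendentalEntire f) (hR : 0 < R)
    (hM : ∀ r : ℝ, R ≤ r → r < maxModulus f r) {L : ℤ}
    (hmc : ¬ ∃ U : Set ℂ, IsComponentOf U (fatouSet f) ∧ IsMultiplyConnected U) {a : ℂ}
    (ha : a ∈ juliaSet f) {z : ℂ} {r : ℝ} (hr : 0 < r) (hF : Metric.ball z r ⊆ fatouSet f)
    (hz : z ∈ level f R L) : Metric.ball z (r / 2) ⊆ level f R L := by
  intro w hw
  rw [mem_level_iff] at hz ⊢
  by_contra! hcon
  obtain ⟨m, hm⟩ := hcon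
  set p := L.toNat
  set q := (-L).toNat
  have hshift : ∀ k, (maxModulus f)^[k + 1 + (m + p)] R =
      maxModulus f ((maxModulus f)^[k + (m + p)] R) := fun k => by
    rw [add_right_comm, Function.iterate_succ_apply']
  refine not_isBounded_of_ratio_growth hf (x := fun k => ‖f^[k + (m + q)] w‖)
    (y := fun k => (maxModulus f)^[k + (m + p)] R) (c := ‖a‖ + Real.exp 768 * ‖a‖)
    (Real.exp_pos 768) (fun k => ?_) (fun k => ?_) hshift
    ((tendsto_add_atTop_iff_nat (m + p)).mpr (tendsto_maxModulus_iterate hf.1 hR hM))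
    (fun k => ?_)
  · rw [Function.iterate_add_apply f k, Function.iterate_add_apply (maxModulus f) k]
    exact norm_iterate_lt hf.1 hf.not_const hm k
  · rw [add_right_comm, Function.iterate_succ_apply']
    exact norm_le_maxModulus hf.1 le_rfl
  · have h1 := exists_norm_iterate_sub_le hf hmc ha hr hF
      (Metric.mem_ball_self (by linarith)) hw (k + (m + q))
    have h2 := hz (k + m)
    rw [add_assoc, add_assoc] at h2
    have h3 := norm_le_norm_sub_add (f^[k + (m + q)] z) a
    have h4 := mul_le_mul_of_nonneg_left (norm_sub_le (f^[k + (m + q)] w) a)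
      (Real.exp_pos 768).le
    linarith

lemma subset_level_of_mem (hf : IsTranscendentalEntire f) (hR : 0 < R)
    (hM : ∀ r : ℝ, R ≤ r → r < maxModulus f r) {L : ℤ}
    (hmc : ¬ ∃ U : Set ℂ, IsComponentOf U (fatouSet f) ∧ IsMultiplyConnected U)
    (hJ : (juliaSet f).Nonempty) {U : Set ℂ} (hU : IsPreconnected U) (hUF : U ⊆ fatouSet f)
    {z : ℂ} (hzU : z ∈ U) (hz : z ∈ level f R L) : U ⊆ level f R L := by
  obtain ⟨a, ha⟩ := hJ
  intro w hw
  have key := hU.induction₂ (fun x y => x ∈ level f R L ↔ y ∈ level f R L) (fun x hx => ?_)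
    (fun _ _ _ _ _ _ h1 h2 => h1.trans h2) (fun _ _ _ _ h => h.symm) hzU hw
  · exact key.mp hz
  · obtain ⟨r, hr, hball⟩ := Metric.isOpen_iff.mp isOpen_fatouSet x (hUF hx)
    filter_upwards [mem_nhdsWithin_of_mem_nhds
      (Metric.ball_mem_nhds x (ε := r / 4) (by linarith))] with y hy
    rw [Metric.mem_ball] at hy
    constructor
    · intro h
      exact ball_subset_level hf hR hM hmc ha hr hball h (by rw [Metric.mem_ball]; linarith)
    · intro h
      refine ball_subset_level hf hR hM hmc ha (z := y) (r := r / 2) (by linarith)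
        ((Metric.ball_subset_ball' (by linarith)).trans hball) h ?_
      rw [Metric.mem_ball, dist_comm]; linarith

/-- In the absence of multiply connected Fatou components, the components of the part of a level
in the Julia set are unbounded. -/
lemma not_isBounded_connectedComponentIn_level_inter_juliaSet (hf : IsTranscendentalEntire f)
    (hR : 0 < R) (hM : ∀ r : ℝ, R ≤ r → r < maxModulus f r) {L : ℤ}
    (hmc : ¬ ∃ U : Set ℂ, IsComponentOf U (fatouSet f) ∧ IsMultiplyConnected U) {z : ℂ}
    (hz : z ∈ level f R L ∩ juliaSet f) :
    ¬ Bornology.IsBounded (connectedComponentIn (level f R L ∩ juliaSet f) z) := by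
  intro hb
  have hAcl := isClosed_level hf.1 R L
  obtain ⟨V, hVo, hVb, hzV, hVE⟩ :=
    exists_isOpen_disjoint_frontier (hAcl.inter isClosed_juliaSet) hz hb
  obtain ⟨W, hWo, hWb, hzW, hWV, hWc⟩ := exists_isPreconnected_frontier hVo hVb hzV
  have hF : ∀ p ∈ frontier W, p ∈ level f R L → p ∈ fatouSet f := fun p hp hpA => by
    by_contra hpF
    exact disjoint_left.mp hVE (hWV hp) ⟨hpA, hpF⟩
  obtain ⟨y, hy, hyW⟩ := not_subset.mp fun h =>
    not_isBounded_connectedComponentIn_level hf hz.1 (hWb.subset h)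
  obtain ⟨b, hbK, hbW⟩ := inter_frontier_nonempty_of_isPreconnected
    isPreconnected_connectedComponentIn ⟨z, mem_connectedComponentIn hz.1, hzW⟩ ⟨y, hy, hyW⟩
  have hbA : b ∈ level f R L := connectedComponentIn_subset _ _ hbK
  have hbF := hF b hbW hbA
  set U := connectedComponentIn (fatouSet f) b with hUdef
  have hUcomp : IsComponentOf U (fatouSet f) := ⟨b, hbF, rfl⟩
  have hbU : b ∈ U := mem_connectedComponentIn hbF
  have hclU : closure U ⊆ level f R L := closure_minimal
    (subset_level_of_mem hf hR hM hmc ⟨z, hz.2⟩ hUcomp.isPreconnected hUcomp.subset hbU hbA) hAcl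
  -- U is relatively closed in the frontier: its limit points there lie in the closed level, hence
  -- in F, hence in U.
  have hcl : ∀ p ∈ frontier W, p ∈ closure U → p ∈ U := fun p hp hpU => by
    have hpF := hF p hp (hclU hpU)
    obtain ⟨v, hv, hvU⟩ := mem_closure_iff.mp hpU _ isOpen_fatouSet.connectedComponentIn
      (mem_connectedComponentIn hpF)
    exact hUcomp.subset_of_inter_nonempty isPreconnected_connectedComponentIn
      (connectedComponentIn_subset _ _) ⟨v, hv, hvU⟩ (mem_connectedComponentIn hpF)
  have hWU : frontier W ⊆ U := by
    intro p hp
    by_contra hpU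
    obtain ⟨v, -, hv1, hv2⟩ := hWc U (closure U)ᶜ hUcomp.isOpen isClosed_closure.isOpen_compl
      (fun v hv => by
        by_cases h : v ∈ closure U
        · exact Or.inl (hcl v hv h)
        · exact Or.inr h)
      ⟨b, hbW, hbU⟩ ⟨p, hp, fun h => hpU (hcl p hp h)⟩
    exact hv2 (subset_closure hv1)
  exact hmc ⟨U, hUcomp, isMultiplyConnected_of_frontier_subset hWo hWb hWU hzW
    fun h => hz.2 (hUcomp.subset h)⟩

/-- A multiply connected Fatou component produces a bounded component of the part of any level
in the Julia set. -/
lemma exists_isBounded_component_of_isMultiplyConnected (hf : IsTranscendentalEntire f)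
    (hR : 0 < R) (hM : ∀ r : ℝ, R ≤ r → r < maxModulus f r) (L : ℤ) {U : Set ℂ}
    (hU : IsComponentOf U (fatouSet f)) (hm : IsMultiplyConnected U) :
    ∃ C, IsComponentOf C (level f R L ∩ juliaSet f) ∧ Bornology.IsBounded C := by
  have hc := hf.not_const
  by_contra! hcon
  have himg : ∀ m, f^[m] '' U ⊆ fatouSet f := by
    rintro m _ ⟨u, hu, rfl⟩
    exact iterate_mem_fatouSet hf.1 hc (hU.subset hu) m
  have hmem : ∀ {z : ℂ} {r : ℝ}, ‖z‖ < r → z ∈ Metric.ball (0 : ℂ) r := fun h => by simpa using h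
  by_cases hne : (level f R L ∩ juliaSet f).Nonempty
  · obtain ⟨z, hz⟩ := hne
    obtain ⟨m, hS⟩ := hm.exists_forall_inter_nonempty hf.1 hc hU
      (show 0 < ‖z‖ + 1 by positivity)
    obtain ⟨w, hw, hwU⟩ := hS _ isPreconnected_connectedComponentIn (hcon _ ⟨z, hz, rfl⟩)
      ⟨z, mem_connectedComponentIn hz, hmem (by linarith)⟩
    exact (connectedComponentIn_subset _ _ hw).2 (himg m hwU)
  -- With no point of A in J the hypothesis on components is vacuous, so unbounded components of A
  -- itself are used; the radius covers both z and f(z), giving one common m.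
  · have hAF : level f R L ⊆ fatouSet f := fun w hw => by
      by_contra hwF
      exact hne ⟨w, hw, hwF⟩
    obtain ⟨z, hz⟩ := level_nonempty hf hR hM L
    have hfz := map_mem_level hM hz
    obtain ⟨m, hS⟩ := hm.exists_forall_inter_nonempty hf.1 hc hU
      (show 0 < ‖z‖ + ‖f z‖ + 1 by positivity)
    have key : ∀ w ∈ level f R L, ‖w‖ < ‖z‖ + ‖f z‖ + 1 →
        (connectedComponentIn (level f R L) w ∩ f^[m] '' U).Nonempty := fun w hw hlt =>
      hS _ isPreconnected_connectedComponentIn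
        (not_isBounded_connectedComponentIn_level hf hw)
        ⟨w, mem_connectedComponentIn hw, hmem hlt⟩
    obtain ⟨u, hu, huU⟩ := key z hz (by linarith [norm_nonneg (f z)])
    obtain ⟨v, hv, hvU⟩ := key (f z) hfz (by linarith [norm_nonneg z])
    have hV : IsComponentOf (connectedComponentIn (fatouSet f) z) (fatouSet f) :=
      ⟨z, hAF hz, rfl⟩
    have hzV := mem_connectedComponentIn (hAF hz)
    have h1 := hV.subset_of_inter_nonempty isPreconnected_connectedComponentIn
      ((connectedComponentIn_subset _ _).trans hAF) ⟨z, mem_connectedComponentIn hz, hzV⟩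
    have h2 := hV.subset_of_inter_nonempty
      (hU.isPreconnected.image _ (differentiable_iterate hf.1 m).continuous.continuousOn)
      (himg m) ⟨u, huU, h1 hu⟩
    have h3 := hV.subset_of_inter_nonempty isPreconnected_connectedComponentIn
      ((connectedComponentIn_subset _ _).trans hAF) ⟨v, hv, h2 hvU⟩
    exact not_mem_of_map_mem hf hR hM hV.isPreconnected hV.subset hz hzV
      (h3 (mem_connectedComponentIn hfz))

end FastEscaping

theorem theorem1p3 (f : ℂ → ℂ) (hf : FastEscaping.IsTranscendentalEntire f)
    (R : ℝ) (hR : 0 < R) (hM : ∀ r : ℝ, R ≤ r → r < FastEscaping.maxModulus f r) (L : ℤ) :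
    (∀ C : Set ℂ,
        FastEscaping.IsComponentOf C (FastEscaping.level f R L ∩ FastEscaping.juliaSet f) →
          ¬ Bornology.IsBounded C) ↔
      ¬ ∃ U : Set ℂ, FastEscaping.IsComponentOf U (FastEscaping.fatouSet f) ∧
        FastEscaping.IsMultiplyConnected U := by
  constructor
  · rintro h ⟨U, hU, hm⟩
    obtain ⟨C, hC, hCb⟩ :=
      FastEscaping.exists_isBounded_component_of_isMultiplyConnected hf hR hM L hU hm
    exact h C hC hCb
  · rintro hmc _ ⟨z, hz, rfl⟩
    exact FastEscaping.not_isBounded_connectedComponentIn_level_inter_juliaSet hf hR hM hmc hz
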